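/- **Setting.** Let $R$ be an irreducible reduced crystallographic root system with a chosen base $(\alpha_k)_{k\in I}$, highest root $\Theta$, Weyl group $W$ (length function $\ell$, longest element $w_0$), weight lattice $P$, coroot lattice $Q^\vee$ and coweight lattice $P^\vee$. Let $S=\mathrm{Sym}(P)=H_T^*(\mathrm{pt})$ and $F=\mathrm{Frac}(S)$. Let $\widetilde W_{\rm aff}=P^\vee\rtimes W\supset W_{\rm aff}=Q^\vee\rtimes W$, with translations $t_{\lambda}$ and with $s_0=t_{\Theta^\vee}s_\Theta$; $\widetilde W_{\rm aff}$ acts on $S$ and $F$ through $W$. Let $W_{\rm aff}^-$ be the set of minimal length representatives of the cosets in $W_{\rm aff}/W$. Let $\widetilde Q_{\rm aff}=\bigoplus_{x\in\widetilde W_{\rm aff}}F\,\delta_x$, with $\delta_x\delta_y=\delta_{xy}$ and $\delta_x s=x(s)\delta_x$. Put $A_k=\frac1{\alpha_k}(\delta_e-\delta_{s_k})$ for $k\in I$, $A_0=-\frac1\Theta(\delta_e-\delta_{s_0})$, and $A_x=A_{k_1}\cdots A_{k_\ell}$ for a reduced expression $x=s_{k_1}\cdots s_{k_\ell}$ of $x\in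 W_{\rm aff}$. For $u,v\in W$ let $\xi^u(v)$ be the value at the fixed point $v$ of the basis $(\xi^u)_{u\in W}$ of $H_T^*(G/B)$ dual to $(A_v)_{v\in W}$; that is, if $A_v=\sum_{w\in W} c_{v,w}\delta_w$ then $\sum_{w\in W} c_{v,w}\,\xi^u(w)=\delta_{u,v}$. Let $G$ be the simply connected group with root system $R$ and $K\subset G$ a maximal compact subgroup. By localization at the $T$-fixed points of $\Omega K$, the equivariant homology $H_*^T(\Omega K)$, with its Pontryagin product, is a subring of $F[P^\vee]=\bigoplus_{\lambda\in P^\vee}F\psi_\lambda$ with $\psi_\lambda\psi_\mu=\psi_{\lambda+\mu}$. The ring $\widetilde Q_{\rm aff}$ acts on $F[P^\vee]$ by $\delta_{ut_\lambda}\cdot(c\,\psi_\mu)=u(c)\,\psi_{u(\lambda+\mu)}$; the Schubert classes are $\xi_x=A_x\cdot\psi_0$ for $x\in W_{\rm aff}^-$, and $H_*^T(\Omega K)=\sum_{x\in W_{\rm aff}^-}S\,\xi_x$. Let $j$ be the ring homomorphism $F[P^\vee]\to\widetilde Q_{\rm aff}$ with $c\,\psi_\lambda\mapsto c\,\delta_{t_\lambda}$;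 its restriction to $H_*^T(\Omega K)$ is the map $j$ into the centralizer of $S$ in the affine nil-Hecke ring. Let $i\in I$ be a cominuscule node: the fundamental coweight $\varpi_i^\vee$ satisfies $\langle\varpi_i^\vee,\alpha\rangle\in\{0,1\}$ for every positive root $\alpha$. Let $v_i$ be the shortest element of $W$ with $v_i(\varpi_i^\vee)=w_0(\varpi_i^\vee)$, put $\tau_i=v_it_{-\varpi_i^\vee}\in\widetilde W_{\rm aff}$, and write $\tau_i(x)=\tau_ix\tau_i^{-1}$ for $x\in \widetilde W_{\rm aff}$. Let $\le$ be the Bruhat order on $W$, and $\le_L$ the left weak order on $W$: $w\le_L v$ if and only if $\ell(v)=\ell(vw^{-1})+\ell(w)$. **Proposition.** Then $\tau_i(v_i)\in W_{\rm aff}^-$, and $$ j(\xi_{\tau_i(v_i)})=\sum_{w\le_L v_i}\ \sum_{v\le v_i^{-1}}\tau_i\bigl(\xi^v(v_i^{-1})\bigr)\,A_{\tau_i(w)v_iw^{-1}}\,A_v . $$ Moreover, for every $x\in H_*^T(\Omega K)$, $$ \xi_{\tau_i(v_i)}\cdot x=\sum_{w\le_L v_i}\ \sum_{v\le v_i^{-1}}\tau_i\bigl(\xi^v(v_i^{-1})\bigr)\,A_{\tau_i(w)v_iw^{-1}}\cdot\bigl(A_v\cdot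 x\bigr). $$ -/

import Mathlib

noncomputable section

open scoped Classical

namespace AffineGrassmannian

variable {ι K M N : Type*} [Field K] [AddCommGroup M] [Module K M] [AddCommGroup N] [Module K N]

/-! ### Lattices, and the action of the Weyl group on them -/

section Lattices

variable (P : RootPairing ι K M N)

/-- The weight lattice: the `x` with `⟨x, β^∨⟩ ∈ ℤ` for all coroots `β^∨`. -/
def weightLattice : AddSubgroup M where
  carrier := {x | ∀ k, ∃ n : ℤ, P.toLinearMap x (P.coroot k) = n}
  zero_mem' k := ⟨0, by simp⟩
  add_mem' {x y} hx hy k := by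
    obtain ⟨m, hm⟩ := hx k
    obtain ⟨n, hn⟩ := hy k
    exact ⟨m + n, by simp [hm, hn]⟩
  neg_mem' {x} hx k := by
    obtain ⟨m, hm⟩ := hx k
    exact ⟨-m, by simp [hm]⟩

/-- The coweight lattice `P^∨`: the `x` with `⟨β, x⟩ ∈ ℤ` for all roots `β`. -/
def coweightLattice : AddSubgroup N where
  carrier := {x | ∀ k, ∃ n : ℤ, P.toLinearMap (P.root k) x = n}
  zero_mem' k := ⟨0, by simp⟩
  add_mem' {x y} hx hy k := by
    obtain ⟨m, hm⟩ := hx k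
    obtain ⟨n, hn⟩ := hy k
    exact ⟨m + n, by simp [hm, hn]⟩
  neg_mem' {x} hx k := by
    obtain ⟨m, hm⟩ := hx k
    exact ⟨-m, by simp [hm]⟩

/-- The coroot lattice `Q^∨`. -/
def corootLattice : AddSubgroup N := AddSubgroup.closure (Set.range P.coroot)

lemma coroot_mem_corootLattice (k : ι) : P.coroot k ∈ corootLattice P :=
  AddSubgroup.subset_closure ⟨k, rfl⟩

lemma root_mem_weightLattice [P.IsCrystallographic] (k : ι) : P.root k ∈ weightLattice P :=
  fun l => by
    obtain ⟨n, hn⟩ := P.exists_value (S := ℤ) k l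
    exact ⟨n, by simpa using hn.symm⟩

lemma coroot_mem_coweightLattice [P.IsCrystallographic] (k : ι) :
    P.coroot k ∈ coweightLattice P :=
  fun l => by
    obtain ⟨n, hn⟩ := P.exists_value (S := ℤ) l k
    exact ⟨n, by simpa using hn.symm⟩

/-- An automorphism of the root pairing acts on `M` on the left and on `N` on the right, by mutually
transposed maps. -/
lemma pairing_smul (g : P.Aut) (x : M) (y : N) :
    P.toLinearMap (g • x) y = P.toLinearMap x (MulOpposite.op g • y) := by
  have h := RootPairing.Hom.weight_coweight_transpose_apply P P y g.toHom
  exact congrArg (fun f => f x) h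

lemma aut_smul_root (g : P.Aut) (k : ι) : g • P.root k = P.root (g.toHom.indexEquiv k) :=
  RootPairing.Hom.root_weightMap_apply P P k g.toHom

lemma op_aut_smul_coroot (g : P.Aut) (k : ι) :
    MulOpposite.op g • P.coroot k = P.coroot (g.toHom.indexEquiv.symm k) :=
  RootPairing.Hom.coroot_coweightMap_apply P P k g.toHom

/-- The action of the Weyl group on the weight lattice. -/
instance instWeightAction : DistribMulAction P.weylGroup (weightLattice P) where
  smul w x := ⟨(w : P.Aut) • (x : M), fun k => by
    rw [pairing_smul, op_aut_smul_coroot]; exact x.2 _⟩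
  one_smul x := Subtype.ext (one_smul P.Aut (x : M))
  mul_smul v w x := Subtype.ext (mul_smul (v : P.Aut) (w : P.Aut) (x : M))
  smul_zero w := Subtype.ext (smul_zero (w : P.Aut))
  smul_add w x y := Subtype.ext (smul_add (w : P.Aut) (x : M) (y : M))

/-- The action of the Weyl group on the coweight lattice, dual to the one on weights:
`⟨w x, w y⟩ = ⟨x, y⟩`. -/
instance instCoweightAction : DistribMulAction P.weylGroup (coweightLattice P) where
  smul w y := ⟨MulOpposite.op (w : P.Aut)⁻¹ • (y : N), fun k => by
    rw [← pairing_smul, aut_smul_root]; exact y.2 _⟩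
  one_smul y := Subtype.ext (by
    change MulOpposite.op (1 : P.Aut)⁻¹ • (y : N) = y
    simp)
  mul_smul v w y := Subtype.ext (by
    change MulOpposite.op ((v : P.Aut) * (w : P.Aut))⁻¹ • (y : N) =
      MulOpposite.op (v : P.Aut)⁻¹ • MulOpposite.op (w : P.Aut)⁻¹ • (y : N)
    rw [mul_inv_rev, MulOpposite.op_mul, mul_smul])
  smul_zero w := Subtype.ext (smul_zero (MulOpposite.op (w : P.Aut)⁻¹))
  smul_add w x y := Subtype.ext (smul_add (MulOpposite.op (w : P.Aut)⁻¹) (x : N) (y : N))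

lemma smul_mem_corootLattice (w : P.weylGroup) (y : coweightLattice P)
    (hy : (y : N) ∈ corootLattice P) : ((w • y : coweightLattice P) : N) ∈ corootLattice P := by
  change MulOpposite.op (w : P.Aut)⁻¹ • (y : N) ∈ corootLattice P
  generalize (y : N) = z at hy
  induction hy using AddSubgroup.closure_induction with
  | mem x hx =>
    obtain ⟨k, rfl⟩ := hx
    rw [op_aut_smul_coroot]
    exact coroot_mem_corootLattice P _
  | zero => rw [smul_zero]; exact zero_mem _
  | add x y _ _ hx hy => rw [smul_add]; exact add_mem hx hy
  | neg x _ hx => rw [smul_neg]; exact neg_mem hx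

instance instFiniteWeylGroup [Finite ι] [P.IsRootSystem] : Finite P.weylGroup := by
  refine Finite.of_injective (fun w : P.weylGroup => (w : P.Aut).toHom.indexEquiv) fun v w h => ?_
  refine Subtype.ext (RootPairing.Equiv.weightHom_injective P (LinearEquiv.toLinearMap_injective ?_))
  refine LinearMap.ext_on_range (v := P.root) RootPairing.IsRootSystem.span_root_eq_top fun k => ?_
  change (v : P.Aut) • P.root k = (w : P.Aut) • P.root k
  rw [aut_smul_root, aut_smul_root]
  exact congrArg (fun e : ι ≃ ι => P.root (e k)) h

instance instFreeWeightLattice [Finite ι] [CharZero K] [P.IsRootSystem] :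
    Module.Free ℤ (weightLattice P) := by
  let f : weightLattice P →ₗ[ℤ] (ι → ℤ) :=
    { toFun := fun x k => (x.2 k).choose
      map_add' := fun x y => funext fun k => by
        have h := ((x + y).2 k).choose_spec
        have hx := (x.2 k).choose_spec
        have hy := (y.2 k).choose_spec
        have hxy : P.toLinearMap ((x + y : weightLattice P) : M) (P.coroot k) =
            P.toLinearMap (x : M) (P.coroot k) + P.toLinearMap (y : M) (P.coroot k) := by simp
        have := h.symm.trans (hxy.trans (congrArg₂ (· + ·) hx hy))
        exact_mod_cast this
      map_smul' := fun c x => funext fun k => by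
        have h := ((c • x).2 k).choose_spec
        have hx := (x.2 k).choose_spec
        have hcx : P.toLinearMap ((c • x : weightLattice P) : M) (P.coroot k) =
            (c : K) * P.toLinearMap (x : M) (P.coroot k) := by simp
        have := h.symm.trans (hcx.trans (congrArg ((c : K) * ·) hx))
        exact_mod_cast this }
  have hf : Function.Injective f := by
    rw [injective_iff_map_eq_zero]
    intro x hx
    refine Subtype.ext ((P.eq_zero_iff_forall_coroot'_eq_zero).2 fun k => ?_)
    have h := (x.2 k).choose_spec
    rw [show (x.2 k).choose = 0 from congrFun hx k] at h
    simpa using h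
  exact Module.Free.of_equiv (LinearEquiv.ofInjective f hf).symm

end Lattices

/-! ### The coefficient ring `S` and its field of fractions -/

section Coefficients

variable (P : RootPairing ι K M N)

/-- `S = H^*_T(pt)`, the symmetric algebra of the weight lattice. -/
abbrev S : Type _ := SymmetricAlgebra ℤ (weightLattice P)

/-- The action of the Weyl group on `S` by ring automorphisms, extending the one on weights. -/
instance instSAction : MulSemiringAction P.weylGroup (S P) where
  smul w := SymmetricAlgebra.lift
    ((SymmetricAlgebra.ι ℤ (weightLattice P)).comp
      (DistribSMul.toAddMonoidHom (weightLattice P) w).toIntLinearMap)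
  one_smul s := by
    refine DFunLike.congr_fun (f := SymmetricAlgebra.lift
      ((SymmetricAlgebra.ι ℤ (weightLattice P)).comp
        (DistribSMul.toAddMonoidHom (weightLattice P) (1 : P.weylGroup)).toIntLinearMap))
      (g := AlgHom.id ℤ _) (SymmetricAlgebra.algHom_ext (LinearMap.ext fun x => ?_)) s
    simp
  mul_smul v w s := by
    refine DFunLike.congr_fun (f := SymmetricAlgebra.lift
      ((SymmetricAlgebra.ι ℤ (weightLattice P)).comp
        (DistribSMul.toAddMonoidHom (weightLattice P) (v * w)).toIntLinearMap))
      (g := (SymmetricAlgebra.lift ((SymmetricAlgebra.ι ℤ (weightLattice P)).comp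
        (DistribSMul.toAddMonoidHom (weightLattice P) v).toIntLinearMap)).comp
        (SymmetricAlgebra.lift ((SymmetricAlgebra.ι ℤ (weightLattice P)).comp
        (DistribSMul.toAddMonoidHom (weightLattice P) w).toIntLinearMap)))
      (SymmetricAlgebra.algHom_ext (LinearMap.ext fun x => ?_)) s
    simp [mul_smul]
  smul_zero w := map_zero (SymmetricAlgebra.lift _)
  smul_add w := map_add (SymmetricAlgebra.lift _)
  smul_one w := map_one (SymmetricAlgebra.lift _)
  smul_mul w := map_mul (SymmetricAlgebra.lift _)

/-- `Frac(S)`. -/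
abbrev F : Type _ := FractionRing (S P)

/-- A root as an element of `Frac(S)`. -/
def rootF [P.IsCrystallographic] (k : ι) : F P :=
  algebraMap (S P) (F P)
    (SymmetricAlgebra.ι ℤ (weightLattice P) ⟨P.root k, root_mem_weightLattice P k⟩)

/-- The extended affine Weyl group `P^∨ ⋊ W`. -/
abbrev WExt : Type _ :=
  Multiplicative (coweightLattice P) ⋊[(MulAutMultiplicative (coweightLattice P)).symm.toMonoidHom.comp
    (DistribMulAction.toAddAut P.weylGroup (coweightLattice P))] P.weylGroup

/-- The translation `t_y`, for `y ∈ P^∨`. -/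
def transl (y : coweightLattice P) : WExt P := SemidirectProduct.inl (Multiplicative.ofAdd y)

/-- The inclusion of the Weyl group in the extended affine Weyl group. -/
def fin : P.weylGroup →* WExt P := SemidirectProduct.inr

/-- The `y` in the decomposition `x = t_y w`. -/
def translPart (x : WExt P) : coweightLattice P := x.left.toAdd

/-- The `w` in the decomposition `x = t_y w`. -/
def finPart (x : WExt P) : P.weylGroup := x.right

lemma translPart_mul (x y : WExt P) :
    translPart P (x * y) = translPart P x + finPart P x • translPart P y := rfl

lemma translPart_inv (x : WExt P) :
    translPart P x⁻¹ = (finPart P x)⁻¹ • -translPart P x := rfl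

/-- The affine Weyl group `Q^∨ ⋊ W`, as a subgroup of `P^∨ ⋊ W`. -/
def WAff : Subgroup (WExt P) where
  carrier := {x | (translPart P x : N) ∈ corootLattice P}
  one_mem' := zero_mem (corootLattice P)
  mul_mem' {x y} hx hy := by
    change ((translPart P (x * y) : coweightLattice P) : N) ∈ corootLattice P
    rw [translPart_mul, AddSubgroup.coe_add]
    exact add_mem hx (smul_mem_corootLattice P _ _ hy)
  inv_mem' {x} hx := by
    change ((translPart P x⁻¹ : coweightLattice P) : N) ∈ corootLattice P
    rw [translPart_inv]
    exact smul_mem_corootLattice P _ _ (by rw [AddSubgroup.coe_neg]; exact neg_mem hx)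

variable [Finite ι] [CharZero K] [P.IsRootSystem]

instance instFAction : MulSemiringAction P.weylGroup (F P) :=
  IsFractionRing.mulSemiringAction P.weylGroup (S P) (F P)

/-- The level zero action of the extended affine Weyl group on `Frac(S)`: translations act
trivially. -/
instance instFActionExt : MulSemiringAction (WExt P) (F P) :=
  MulSemiringAction.compHom (F P) (SemidirectProduct.rightHom : WExt P →* P.weylGroup)

lemma transl_smul (y : coweightLattice P) (c : F P) : transl P y • c = c :=
  one_smul P.weylGroup c

/-- The ring `⊕_x Frac(S) δ_x`, over `x` in the extended affine Weyl group, in which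
`δ_x δ_y = δ_{xy}` and `δ_x s = x(s) δ_x`. It contains `⊕_x Frac(S) δ_x` over `x` in the affine
Weyl group as a subring. -/
abbrev QExt : Type _ := SkewMonoidAlgebra (F P) (WExt P)

/-- The element `δ_x`. -/
def delta : WExt P →* QExt P := SkewMonoidAlgebra.of (F P) (WExt P)

end Coefficients

/-! ### Word lengths -/

/-- The length of `g` with respect to a family `s` of generators. -/
def wordLength {G B : Type*} [Monoid G] (s : B → G) (g : G) : ℕ :=
  sInf {n | ∃ l : List B, l.length = n ∧ (l.map s).prod = g}

section Weyl

variable {P : RootPairing ι K M N} (b : P.Base)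

/-- The simple reflections of the Weyl group. -/
def simpleRefl (i : b.support) : P.weylGroup := RootPairing.weylGroup.ofIdx P i

/-- The length function of the Weyl group. -/
def length (w : P.weylGroup) : ℕ := wordLength (simpleRefl b) w

/-- The left weak order: `v = u w` with `ℓ(v) = ℓ(u) + ℓ(w)`. -/
def LeftWeakLE (w v : P.weylGroup) : Prop := length b v = length b (v * w⁻¹) + length b w

/-- The Bruhat order, generated by `u < u s_β` for `β` a root with `ℓ(u) < ℓ(u s_β)`. -/
def BruhatLE : P.weylGroup → P.weylGroup → Prop :=
  Relation.ReflTransGen fun u w =>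
    ∃ k : ι, w = u * RootPairing.weylGroup.ofIdx P k ∧ length b u < length b w

/-- `θ` is (the index of) the highest root: `θ - β` is a sum of simple roots for every root `β`. -/
def IsHighestRoot (θ : ι) : Prop :=
  ∀ k, P.root θ - P.root k ∈ AddSubmonoid.closure (P.root '' b.support)

variable [P.IsRootSystem]

/-- The fundamental coweights, as vectors: the basis dual to the basis of simple roots. -/
def fundCoweightVec (i : b.support) : N := P.flip.toPerfPair.symm (b.toWeightBasis.coord i)

lemma pairing_fundCoweightVec (i : b.support) (x : M) :
    P.toLinearMap x (fundCoweightVec b i) = b.toWeightBasis.coord i x :=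
  congrArg (fun f => f x) (P.flip.toPerfPair.apply_symm_apply (b.toWeightBasis.coord i))

lemma fundCoweightVec_mem (i : b.support) : fundCoweightVec b i ∈ coweightLattice P := by
  intro k
  rw [pairing_fundCoweightVec]
  have hk := b.root_mem_span_int k
  generalize P.root k = x at hk
  induction hk using Submodule.span_induction with
  | mem x hx =>
    obtain ⟨j, hj, rfl⟩ := hx
    have h := b.toWeightBasis_apply ⟨j, hj⟩
    by_cases hij : (⟨j, hj⟩ : b.support) = i
    · exact ⟨1, by rw [← h, Module.Basis.coord_apply, Module.Basis.repr_self, hij]; simp⟩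
    · exact ⟨0, by rw [← h, Module.Basis.coord_apply, Module.Basis.repr_self]; simp [hij]⟩
  | zero => exact ⟨0, by simp⟩
  | add x y _ _ hx hy =>
    obtain ⟨m, hm⟩ := hx
    obtain ⟨n, hn⟩ := hy
    exact ⟨m + n, by rw [map_add, hm, hn]; simp⟩
  | smul c x _ hx =>
    obtain ⟨m, hm⟩ := hx
    exact ⟨c * m, by rw [map_zsmul, hm]; simp⟩

/-- The fundamental coweight `ϖ_i^∨`. -/
def fundCoweight (i : b.support) : coweightLattice P :=
  ⟨fundCoweightVec b i, fundCoweightVec_mem b i⟩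

variable [Finite ι] [CharZero K]

/-- The longest element of the Weyl group. -/
def longest : P.weylGroup := (Finite.exists_max (length b)).choose

/-- The element `v_i`: the shortest element of `W` with `v_i(ϖ_i^∨) = w_0(ϖ_i^∨)`. -/
def vElt (i : b.support) : P.weylGroup :=
  Function.argminOn (length b) {w | w • fundCoweight b i = longest b • fundCoweight b i}
    ⟨longest b, rfl⟩

/-- The element `τ_i = v_i t_{-ϖ_i^∨}`. -/
def tau (i : b.support) : WExt P := fin P (vElt b i) * transl P (-fundCoweight b i)

/-- The conjugate `τ_i(x) = τ_i x τ_i⁻¹`. -/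
def tauConj (i : b.support) (x : WExt P) : WExt P := tau b i * x * (tau b i)⁻¹

/-- The lower interval `{w | w ≤_L v}` of the left weak order. -/
def leftWeakIic (v : P.weylGroup) : Finset P.weylGroup :=
  (Set.toFinite {w | LeftWeakLE b w v}).toFinset

/-- The lower interval `{u | u ≤ v}` of the Bruhat order. -/
def bruhatIic (v : P.weylGroup) : Finset P.weylGroup :=
  (Set.toFinite {u | BruhatLE b u v}).toFinset

variable [P.IsCrystallographic]

/-- The node `i` is cominuscule: `⟨β, ϖ_i^∨⟩ ∈ {0, 1}` for every positive root `β`. -/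
def IsCominuscule [P.IsReduced] (i : b.support) : Prop :=
  ∀ k, b.IsPos k → P.toLinearMap (P.root k) (fundCoweight b i : N) = 0 ∨
    P.toLinearMap (P.root k) (fundCoweight b i : N) = 1

end Weyl

/-! ### The affine nil-Hecke ring -/

section NilHecke

variable {P : RootPairing ι K M N} [P.IsCrystallographic] (b : P.Base) (θ : ι)

/-- The simple reflections of the affine Weyl group: `s_0 = t_{θ^∨} s_θ` (for `none`) and
`s_1, …, s_r`. -/
def affineRefl : Option b.support → WExt P
  | none => transl P ⟨P.coroot θ, coroot_mem_coweightLattice P θ⟩ *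
      fin P (RootPairing.weylGroup.ofIdx P θ)
  | some i => fin P (simpleRefl b i)

/-- The length function of the affine Weyl group (every element of `WAff P` is a product of these reflections). -/
def affineLength (x : WExt P) : ℕ := wordLength (affineRefl b θ) x

/-- The set of minimal length representatives of the cosets `x W`, `x` in the affine Weyl group. -/
def minReps : Set (WExt P) :=
  {x | x ∈ WAff P ∧ ∀ u : P.weylGroup, affineLength b θ x ≤ affineLength b θ (x * fin P u)}

/-- A reduced word for the element `x` of the affine Weyl group. -/
def reducedWord (x : WExt P) : List (Option b.support) :=
  Classical.epsilon fun l => (l.map (affineRefl b θ)).prod = x ∧ l.length = affineLength b θ x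

variable [Finite ι] [CharZero K] [P.IsRootSystem]

/-- `A_0 = -θ⁻¹ (δ_e - δ_{s_0})` and `A_i = α_i⁻¹ (δ_e - δ_{s_i})`. -/
def nilHeckeGen : Option b.support → QExt P
  | none => (-(rootF P θ)⁻¹) • (1 - delta P (affineRefl b θ none))
  | some i => (rootF P i)⁻¹ • (1 - delta P (affineRefl b θ (some i)))

/-- `A_x = A_{i_1} ⋯ A_{i_ℓ}` for a reduced expression `x = s_{i_1} ⋯ s_{i_ℓ}` of the element `x` of
the affine Weyl group. -/
def nilHecke (x : WExt P) : QExt P := ((reducedWord b θ x).map (nilHeckeGen b θ)).prod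

/-- The coefficients `c_{u,v}` in `A_u = ∑_v c_{u,v} δ_v`, for `u, v ∈ W`. -/
def matC : Matrix P.weylGroup P.weylGroup (F P) :=
  fun u v => (nilHecke b θ (fin P u)).coeff (fin P v)

/-- The values `ξ^u(v)` at the `T`-fixed points `v ∈ W` of `G/B` of the basis `(ξ^u)` of `H_T^*(G/B)`
that is dual to the basis `(A_v)` of `H^T_*(G/B)`. Writing `D = (ξ^u(v))` for the matrix of values,
the duality `⟨ξ^u, A_v⟩ = ∑_w c_{v,w} ξ^u(w) = δ_{u,v}` reads `D Cᵀ = 1`. -/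
def schubertValue (u v : P.weylGroup) : F P :=
  letI := Fintype.ofFinite P.weylGroup
  (matC b θ).transpose⁻¹ u v

end NilHecke

/-! ### Equivariant homology of the affine Grassmannian, by localization

`H_*^T(ΩK)` is a subring of `Frac(S)[P^∨]`: the basis element `ψ_y` is the class of the `T`-fixed
loop attached to `y`, and the Pontryagin product is `ψ_y ψ_z = ψ_{y+z}`, `Frac(S)`-bilinearly. -/

section Homology

variable (P : RootPairing ι K M N) [Finite ι] [CharZero K] [P.IsRootSystem]

/-- The localized equivariant homology `Frac(S)[P^∨]` of the adjoint affine Grassmannian. -/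
abbrev LocHomology : Type _ := AddMonoidAlgebra (F P) (coweightLattice P)

/-- The class `ψ_y` of the `T`-fixed point attached to `y`. -/
def psi (y : coweightLattice P) : LocHomology P := AddMonoidAlgebra.single y 1

/-- The action on localized homology: `δ_x ψ_z = ψ_{y + w(z)}` for `x = t_y w`, which is
`Frac(S)`-linear in the acting element and satisfies `δ_x (c f) = x(c) δ_x f`. -/
def act (a : QExt P) (f : LocHomology P) : LocHomology P :=
  a.sum fun x c => f.coeff.sum fun z d =>
    AddMonoidAlgebra.single (translPart P x + finPart P x • z) (c * x • d)

/-- The ring homomorphism `j`, with `j(c ψ_y) = c δ_{t_y}` for `c ∈ Frac(S)`. -/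
def j : LocHomology P →+* QExt P :=
  AddMonoidAlgebra.liftNCRingHom
    (SkewMonoidAlgebra.singleOneRingHom : F P →+* QExt P)
    ((delta P).comp (SemidirectProduct.inl : Multiplicative (coweightLattice P) →* WExt P))
    (fun c y => by
      change SkewMonoidAlgebra.single (1 : WExt P) c *
        SkewMonoidAlgebra.single (transl P y.toAdd) (1 : F P) =
        SkewMonoidAlgebra.single (transl P y.toAdd) (1 : F P) *
        SkewMonoidAlgebra.single (1 : WExt P) c
      rw [SkewMonoidAlgebra.single_mul_single, SkewMonoidAlgebra.single_mul_single, transl_smul]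
      simp)

variable {P} [P.IsCrystallographic] (b : P.Base) (θ : ι)

/-- The Schubert class `ξ_x = A_x · [pt]`, for `x` a minimal representative. -/
def schubertClass (x : WExt P) : LocHomology P := act P (nilHecke b θ x) (psi P 0)

/-- `H_*^T(ΩK) = ⊕ S ξ_x`, over the minimal representatives `x` of the affine Weyl group modulo
`W`. -/
def homologyOmegaK : Submodule (S P) (LocHomology P) :=
  Submodule.span (S P) (schubertClass b θ '' minReps b θ)

end Homology

end AffineGrassmannian

end

open AffineGrassmannian

/-!
Write `ϖ`, `v`, `τ` for `ϖ_i^∨`, `v_i`, `τ_i`. In `W`, the elements `w ≤_L v` are the minimal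
representatives of the cosets modulo the stabilizer of `ϖ` (`mem_leftWeakIic`), so that `w ↦ w(ϖ)` is a
bijection onto the orbit of `ϖ`; moreover `τ(w) v w⁻¹ = τ t_{w(ϖ)}` (`tauConj_mul`), and
`∑_{u ≤ v⁻¹} ξ^u(v⁻¹) A_u = δ_{v⁻¹}` by definition of the `ξ^u` and triangularity of the matrix of the
`A_u` (`sum_schubertValue`). Once the scalars are moved past it, the double sum of the theorem is
therefore `B δ_{v⁻¹}` with `B = ∑_w A_{τ t_{w(ϖ)}}` (`sum_sum_eq`).

The main point is that `B c = v(c) B` for `c` in `Frac(S)`. For a weight `λ` one has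
`A_x λ = x(λ) A_x + ∑_r ⟨λ, r^∨⟩ A_{x s_r}`, summed over the inversions `r` of `x` with
`ℓ(x s_r) = ℓ(x) - 1` (`NilHeckeDatum.elt_mul_wt`). As `τ` permutes the positive affine roots
(`pos_tau_iff`) and `ϖ` is cominuscule, the inversions of `τ t_{w(ϖ)}` are the least positive affine
roots over the roots `β` with `⟨β, w(ϖ)⟩ = 1`. Since `t_μ s_r = t_{s_β μ} s_{r'}` for `μ = w(ϖ)` and `r`,
`r'` the least positive affine roots over `β` and `-β`, and since the `τ t_{w(ϖ)}` all have the same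
length, the lower terms cancel in pairs (`sum_lower_terms_eq_zero`).

Hence `B δ_{v⁻¹}` commutes with `Frac(S)`. As `W` acts faithfully on weights, it is supported on
translations, which means that it equals `j(f)` for some `f`. As `j(f)` acts as multiplication by `f`,
one recovers `f = B δ_{v⁻¹} · ψ_0 = B · ψ_0`. If `w ≠ v` then `w(ϖ)` is not antidominant, so
`τ t_{w(ϖ)}` has a right descent in `W` and `A_{τ t_{w(ϖ)}}` kills `ψ_0`. The remaining term `w = v` is
the Schubert class of `τ t_{v(ϖ)} = τ(v)` (`j_schubertClass`). The formula for products follows, as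
multiplication by the Schubert class is the action of its image under `j`.

That `A_x` does not depend on the reduced word (`NilHeckeDatum.word_eq_word`) is proved along the way,
for a group acting on a set of abstract roots; this covers the finite and the affine Weyl group at
once. By the exchange property one reduces to two alternating words in two letters. By induction the
difference of the two products has the same commutation relation with weights as `δ_x`, without lower
terms, so it is a multiple of `δ_x`. It also lies in the kernel of `∑ c_x δ_x ↦ ∑ c_x`, as each `A_k`
does, and is thus zero.
-/

set_option linter.unusedSectionVars false

namespace AffineGrassmannian

/-! ### Abstract reflection systems -/

/-- A group `G` acting on a set `Φ` of "roots" with a sign, a reflection for each root, and a family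
of simple roots such that each simple reflection permutes the positive roots other than its own
simple root. The finite and the affine Weyl groups are both instances. -/
structure ReflSys (G Φ B : Type*) [Group G] where
  /-- The action of the group on the roots. -/
  act : G →* Equiv.Perm Φ
  /-- The negative of a root. -/
  neg : Φ → Φ
  /-- The positive roots. -/
  pos : Φ → Prop
  /-- The reflection in a root. -/
  refl : Φ → G
  /-- The simple roots. -/
  simple : B → Φ
  pos_neg : ∀ r, pos (neg r) ↔ ¬ pos r
  act_neg : ∀ g r, act g (neg r) = neg (act g r)
  refl_act : ∀ g r, refl (act g r) = g * refl r * g⁻¹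
  act_refl_self : ∀ r, act (refl r) r = neg r
  refl_mul_self : ∀ r, refl r * refl r = 1
  simple_pos : ∀ k, pos (simple k)
  simple_perm : ∀ k r, pos r → r ≠ simple k → pos (act (refl (simple k)) r)

namespace ReflSys

variable {G Φ B : Type*} [Group G] (R : ReflSys G Φ B)

/-- The simple reflections. -/
def s (k : B) : G := R.refl (R.simple k)

/-- The group element spelled by a word in the simple reflections. -/
def wordProd (l : List B) : G := (l.map R.s).prod

/-- A word is reduced if no shorter word spells the same element. -/
def Reduced (l : List B) : Prop := ∀ l', R.wordProd l' = R.wordProd l → l.length ≤ l'.length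

/-- The length with respect to the simple reflections. -/
noncomputable def len (g : G) : ℕ := wordLength R.s g

/-- The letters of a word, each recorded as the root `r` such that deleting the letter multiplies the
element by the reflection in `r` on the right, together with the word left after the deletion. For a
reduced word these `r` are the inversions of the element. -/
def inv : List B → List (Φ × List B)
  | [] => []
  | k :: l => (R.act (R.wordProd l)⁻¹ (R.simple k), l) ::
      (inv l).map fun p => (p.1, k :: p.2)

@[simp] lemma wordProd_nil : R.wordProd [] = 1 := rfl

@[simp] lemma wordProd_cons (k : B) (l : List B) :
    R.wordProd (k :: l) = R.s k * R.wordProd l := by simp [wordProd]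

@[simp] lemma wordProd_append (l m : List B) :
    R.wordProd (l ++ m) = R.wordProd l * R.wordProd m := by simp [wordProd]

@[simp] lemma s_mul_self (k : B) : R.s k * R.s k = 1 := R.refl_mul_self _

@[simp] lemma s_mul_cancel_left (k : B) (g : G) : R.s k * (R.s k * g) = g := by
  rw [← mul_assoc, s_mul_self, one_mul]

@[simp] lemma s_mul_cancel_right (k : B) (g : G) : g * R.s k * R.s k = g := by
  rw [mul_assoc, s_mul_self, mul_one]

@[simp] lemma s_inv (k : B) : (R.s k)⁻¹ = R.s k := inv_eq_of_mul_eq_one_left (R.s_mul_self k)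

@[simp] lemma refl_inv (r : Φ) : (R.refl r)⁻¹ = R.refl r :=
  inv_eq_of_mul_eq_one_left (R.refl_mul_self r)

lemma act_mul (g h : G) (r : Φ) : R.act (g * h) r = R.act g (R.act h r) := by
  rw [map_mul]; rfl

@[simp] lemma act_inv_act (g : G) (r : Φ) : R.act g⁻¹ (R.act g r) = r := by
  rw [← act_mul]; simp

@[simp] lemma act_act_inv (g : G) (r : Φ) : R.act g (R.act g⁻¹ r) = r := by
  rw [← act_mul]; simp

@[simp] lemma act_one (r : Φ) : R.act 1 r = r := by simp

@[simp] lemma act_s_simple (k : B) : R.act (R.s k) (R.simple k) = R.neg (R.simple k) :=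
  R.act_refl_self _

@[simp] lemma neg_neg (r : Φ) : R.neg (R.neg r) = r := by
  conv_lhs => rw [← R.act_refl_self r, ← R.act_neg, ← R.act_refl_self r, ← act_mul,
    R.refl_mul_self, act_one]

@[simp] lemma refl_neg (r : Φ) : R.refl (R.neg r) = R.refl r := by
  rw [← R.act_refl_self, R.refl_act]; simp [R.refl_mul_self]

/-- The strong exchange condition. -/
lemma exists_mem_inv (l : List B) (r : Φ) (hr : R.pos r) (h : ¬ R.pos (R.act (R.wordProd l) r)) :
    ∃ m, (r, m) ∈ R.inv l := by
  induction l with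
  | nil => simp [hr] at h
  | cons k l ih =>
    by_cases hl : R.pos (R.act (R.wordProd l) r)
    · refine ⟨l, ?_⟩
      have : R.act (R.wordProd l) r = R.simple k := by
        by_contra hne
        rw [wordProd_cons, act_mul] at h
        exact h (R.simple_perm k _ hl hne)
      simp [inv, ← this]
    · obtain ⟨m, hm⟩ := ih hl
      exact ⟨k :: m, List.mem_cons_of_mem _ (List.mem_map.2 ⟨_, hm, rfl⟩)⟩

lemma inv_spec (l : List B) (r : Φ) (m : List B) (h : (r, m) ∈ R.inv l) :
    R.wordProd m = R.wordProd l * R.refl r ∧ m.length + 1 = l.length := by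
  induction l generalizing r m with
  | nil => simp [inv] at h
  | cons k l ih =>
    rcases List.mem_cons.1 h with h | h
    · obtain ⟨rfl, rfl⟩ := Prod.mk.inj h
      rw [R.refl_act]
      change _ = _ * ((R.wordProd m)⁻¹ * R.s k * _) ∧ _
      simp [mul_assoc]
    · obtain ⟨⟨r', m'⟩, h', he⟩ := List.mem_map.1 h
      obtain ⟨rfl, rfl⟩ := Prod.mk.inj he
      obtain ⟨h1, h2⟩ := ih _ _ h'
      simp [h1, h2, mul_assoc]

/-- The exchange condition on the left. -/
lemma exists_left_exchange (l : List B) (k : B)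
    (h : ¬ R.pos (R.act (R.wordProd l)⁻¹ (R.simple k))) :
    ∃ r m, (r, m) ∈ R.inv l ∧ R.wordProd l = R.wordProd (k :: m) ∧ m.length + 1 = l.length := by
  have h1 : R.pos (R.neg (R.act (R.wordProd l)⁻¹ (R.simple k))) := (R.pos_neg _).2 h
  obtain ⟨m, hm⟩ := R.exists_mem_inv l _ h1 (by
    rw [R.act_neg, R.pos_neg, act_act_inv, not_not]; exact R.simple_pos k)
  obtain ⟨h2, h3⟩ := R.inv_spec l _ m hm
  refine ⟨_, m, hm, ?_, h3⟩
  rw [refl_neg, R.refl_act] at h2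
  change _ = _ * (_ * R.s k * _) at h2
  rw [wordProd_cons, h2]
  simp [mul_assoc]

lemma Reduced.tail {R : ReflSys G Φ B} {k : B} {l : List B} (h : R.Reduced (k :: l)) :
    R.Reduced l := fun l' hl' => by
  have := h (k :: l') (by simp [hl'])
  simpa using this

lemma Reduced.of_append_left {R : ReflSys G Φ B} {l m : List B} (h : R.Reduced (l ++ m)) :
    R.Reduced l := fun m' hm' => by
  have := h (m' ++ m) (by simp [hm'])
  simpa using this

lemma Reduced.congr {R : ReflSys G Φ B} {l m : List B} (h : R.Reduced l)
    (hp : R.wordProd m = R.wordProd l) (hlen : m.length ≤ l.length) : R.Reduced m :=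
  fun l' hl' => hlen.trans (h l' (hl'.trans hp))

lemma reduced_cons {k : B} {l : List B} (h : R.Reduced l)
    (hk : R.pos (R.act (R.wordProd l)⁻¹ (R.simple k))) : R.Reduced (k :: l) := by
  intro l' hl'
  have h1 : ¬ R.pos (R.act (R.wordProd l')⁻¹ (R.simple k)) := by
    rw [hl', wordProd_cons, mul_inv_rev, act_mul, s_inv, act_s_simple, R.act_neg, R.pos_neg,
      not_not]
    exact hk
  obtain ⟨-, m, -, hm, hlen⟩ := R.exists_left_exchange l' k h1
  have := h m (by simpa [hm] using hl')
  simp; omega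

lemma pos_of_reduced_cons {k : B} {l : List B} (h : R.Reduced (k :: l)) :
    R.pos (R.act (R.wordProd l)⁻¹ (R.simple k)) := by
  by_contra hk
  obtain ⟨-, m, -, hm, hlen⟩ := R.exists_left_exchange l k hk
  have := h m (by simp [hm])
  simp at this; omega

/-- For a reduced word, the inversions listed by `inv` are exactly the positive roots that the
element makes negative. -/
lemma mem_inv_iff {l : List B} (h : R.Reduced l) (r : Φ) :
    r ∈ (R.inv l).map Prod.fst ↔ R.pos r ∧ ¬ R.pos (R.act (R.wordProd l) r) := by
  constructor
  · intro hr
    induction l with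
    | nil => simp [inv] at hr
    | cons k l ih =>
      have hk := R.pos_of_reduced_cons h
      simp only [inv, List.map_cons, List.map_map, List.mem_cons] at hr
      rcases hr with rfl | hr
      · refine ⟨hk, ?_⟩
        rw [wordProd_cons, act_mul, act_act_inv, act_s_simple, R.pos_neg, not_not]
        exact R.simple_pos k
      · obtain ⟨h1, h2⟩ := ih h.tail (by simpa [Function.comp_def] using hr)
        refine ⟨h1, ?_⟩
        rw [wordProd_cons, act_mul, ← R.pos_neg, ← R.act_neg]
        refine R.simple_perm k _ ((R.pos_neg _).2 h2) fun he => ?_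
        rw [← he, ← R.act_neg, act_inv_act, R.pos_neg] at hk
        exact hk h1
  · rintro ⟨h1, h2⟩
    obtain ⟨m, hm⟩ := R.exists_mem_inv l r h1 h2
    exact List.mem_map.2 ⟨_, hm, rfl⟩

lemma nodup_inv {l : List B} (h : R.Reduced l) : ((R.inv l).map Prod.fst).Nodup := by
  induction l with
  | nil => simp [inv]
  | cons k l ih =>
    simp only [inv, List.map_cons, List.map_map, List.nodup_cons]
    refine ⟨fun hm => ?_, ?_⟩
    · have := ((R.mem_inv_iff h.tail (R.act (R.wordProd l)⁻¹ (R.simple k))).1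
        (by simpa [Function.comp_def] using hm)).2
      rw [act_act_inv] at this
      exact this (R.simple_pos k)
    · simpa [Function.comp_def] using ih h.tail

@[simp] lemma length_inv (l : List B) : (R.inv l).length = l.length := by
  induction l with
  | nil => rfl
  | cons k l ih => simp [inv, ih]

lemma inv_append {l₁ l₂ : List B} {r : Φ} {m : List B} (h : (r, m) ∈ R.inv (l₁ ++ l₂)) :
    (∃ r' m₁, (r', m₁) ∈ R.inv l₁ ∧ m = m₁ ++ l₂) ∨ ∃ m₂, (r, m₂) ∈ R.inv l₂ ∧ m = l₁ ++ m₂ := by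
  induction l₁ generalizing m with
  | nil => exact Or.inr ⟨m, h, rfl⟩
  | cons k l ih =>
    rcases List.mem_cons.1 h with h | h
    · obtain ⟨-, rfl⟩ := Prod.mk.inj h
      exact Or.inl ⟨_, _, List.mem_cons_self, rfl⟩
    · obtain ⟨⟨r', m'⟩, h', he⟩ := List.mem_map.1 h
      obtain ⟨rfl, rfl⟩ := Prod.mk.inj he
      rcases ih h' with ⟨r₁, m₁, h₁, rfl⟩ | ⟨m₂, h₂, rfl⟩
      · exact Or.inl ⟨r₁, k :: m₁, List.mem_cons_of_mem _ (List.mem_map.2 ⟨_, h₁, rfl⟩), rfl⟩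
      · exact Or.inr ⟨m₂, h₂, rfl⟩

/-- The alternating word `a b a b ⋯` with `n` letters. -/
def alt (a b : B) : ℕ → List B
  | 0 => []
  | n + 1 => a :: alt b a n

@[simp] lemma length_alt (a b : B) (n : ℕ) : (alt a b n).length = n := by
  induction n generalizing a b with
  | zero => rfl
  | succ n ih => simp [alt, ih]

/-- Deleting a letter of an alternating word leaves an alternating word (if it was the first or the
last letter) or a word that is not reduced. -/
lemma inv_alt {a b : B} {n : ℕ} {r : Φ} {m : List B} (h : (r, m) ∈ R.inv (alt a b (n + 1))) :
    m = alt a b n ∨ m = alt b a n ∨ ¬ R.Reduced m := by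
  induction n generalizing a b m with
  | zero =>
    simp only [alt, inv] at h
    simp at h
    simp [h.2, alt]
  | succ n ih =>
    rcases List.mem_cons.1 h with h | h
    · obtain ⟨-, rfl⟩ := Prod.mk.inj h
      exact Or.inr (Or.inl rfl)
    · obtain ⟨⟨r', m'⟩, h', he⟩ := List.mem_map.1 h
      obtain ⟨rfl, rfl⟩ := Prod.mk.inj he
      rcases ih h' with rfl | rfl | hm
      · exact Or.inl rfl
      · rcases n with _ | n
        · exact Or.inl rfl
        · refine Or.inr (Or.inr fun hred => ?_)
          have := hred (alt b a n) (by simp [alt])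
          simp at this
      · exact Or.inr (Or.inr fun hred => hm hred.tail)

/-- The induction for `exists_alt`: while the exchange condition deletes a letter of the remainder
`m`, the alternating beginning grows by one letter. -/
lemma exists_alt_aux {a b : B} {x : G} (hb : ¬ R.pos (R.act x⁻¹ (R.simple b)))
    (ha : ¬ R.pos (R.act x⁻¹ (R.simple a))) (m : List B) (n : ℕ)
    (hx : R.wordProd (alt a b (n + 1) ++ m) = x) (hred : R.Reduced (alt a b (n + 1) ++ m)) :
    ∃ k m', R.wordProd (alt a b (k + 1) ++ m') = x ∧ R.wordProd (alt b a (k + 1) ++ m') = x ∧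
      k + 1 + m'.length = n + 1 + m.length := by
  induction hN : m.length using Nat.strong_induction_on generalizing a b m n with
  | _ N IH =>
  obtain ⟨r, w, hw, hxw, hlen⟩ := R.exists_left_exchange _ b (by rw [hx]; exact hb)
  have hred' : R.Reduced (b :: w) := hred.congr hxw.symm (by simp; simp at hlen; omega)
  rcases R.inv_append hw with ⟨r', m₁, h₁, rfl⟩ | ⟨m₂, h₂, rfl⟩
  · rcases R.inv_alt h₁ with rfl | rfl | hm
    · exact ⟨n, m, hx, by rw [← hx, hxw]; rfl, by omega⟩
    · rcases n with _ | n
      · exact ⟨0, m, hx, by rw [← hx, hxw]; rfl, by omega⟩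
      · exfalso
        have := hred' (alt a b n ++ m) (by simp [alt])
        simp at this
    · exact absurd hred'.tail.of_append_left hm
  · have hl := (R.inv_spec m r m₂ h₂).2
    obtain ⟨k, m', h1, h2, h3⟩ := IH m₂.length (by omega) ha hb m₂ (n + 1) (by rw [← hx, hxw]; rfl)
      hred' rfl
    exact ⟨k, m', h2, h1, by omega⟩

/-- An element with two left descents `a` and `b` has reduced words beginning
`a b a ⋯` and `b a b ⋯`, equally far and with the same remainder. -/
lemma exists_alt {a b : B} {l l' : List B} (hl : R.Reduced (a :: l)) (hl' : R.Reduced (b :: l'))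
    (h : R.wordProd (a :: l) = R.wordProd (b :: l')) :
    ∃ k m', R.wordProd (alt a b (k + 1) ++ m') = R.wordProd (a :: l) ∧
      R.wordProd (alt b a (k + 1) ++ m') = R.wordProd (a :: l) ∧
      k + 1 + m'.length = (a :: l).length := by
  have key : ∀ (k : B) (m : List B), R.Reduced (k :: m) →
      ¬ R.pos (R.act (R.wordProd (k :: m))⁻¹ (R.simple k)) := fun k m hm => by
    rw [wordProd_cons, mul_inv_rev, act_mul, s_inv, act_s_simple, R.act_neg, R.pos_neg, not_not]
    exact R.pos_of_reduced_cons hm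
  obtain ⟨k, m', h1, h2, h3⟩ := R.exists_alt_aux (x := R.wordProd (a :: l)) (a := a) (b := b)
    (by rw [h]; exact key b l' hl') (key a l hl) l 0 rfl hl
  exact ⟨k, m', h1, h2, by simp; omega⟩

lemma alt_mul_inv (a b : B) (n : ℕ) :
    R.wordProd (alt a b n) * (R.wordProd (alt b a n))⁻¹ = (R.s a * R.s b) ^ n := by
  induction n generalizing a b with
  | zero => simp [alt]
  | succ n ih =>
    simp only [alt, wordProd_cons, mul_inv_rev, s_inv]
    rw [show R.s a * R.wordProd (alt b a n) * ((R.wordProd (alt a b n))⁻¹ * R.s b) =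
      R.s a * (R.wordProd (alt b a n) * (R.wordProd (alt a b n))⁻¹) * R.s b by group, ih]
    clear ih
    induction n with
    | zero => simp
    | succ n ih => rw [pow_succ', pow_succ' (R.s a * R.s b), ← ih]; simp [mul_assoc]

/-- If the two alternating words with `n` letters spell the same element, then the dihedral group
generated by the two letters has exponent dividing `2 n`. -/
lemma pow_eq_one_of_alt {a b : B} {n : ℕ}
    (h : R.wordProd (alt a b n) = R.wordProd (alt b a n)) (g : G)
    (hg : g ∈ Subgroup.closure {R.s a, R.s b}) : g ^ (2 * n) = 1 := by
  have h1 : (R.s a * R.s b) ^ n = 1 := by rw [← R.alt_mul_inv, h, mul_inv_cancel]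
  have h2 : ∃ z : ℤ, g = (R.s a * R.s b) ^ z ∨ g = (R.s a * R.s b) ^ z * R.s a := by
    have hconj : ∀ z : ℤ, R.s a * (R.s a * R.s b) ^ z = (R.s a * R.s b) ^ (-z) * R.s a := by
      intro z
      have := conj_zpow (a := R.s a) (b := R.s a * R.s b) (i := z)
      rw [s_inv] at this
      have h3 : R.s a * (R.s a * R.s b) * R.s a = (R.s a * R.s b)⁻¹ := by simp
      rw [h3] at this
      rw [zpow_neg, ← inv_zpow, this]
      simp [mul_assoc]
    induction hg using Subgroup.closure_induction_left with
    | one => exact ⟨0, by simp⟩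
    | mul_left x hx y _ ih =>
      obtain ⟨z, rfl | rfl⟩ := ih <;> rcases hx with rfl | rfl
      · exact ⟨-z, Or.inr (hconj z)⟩
      · refine ⟨-(z + 1), Or.inr ?_⟩
        rw [← hconj, add_comm, zpow_add]; simp [mul_assoc]
      · exact ⟨-z, Or.inl (by rw [← mul_assoc, hconj]; simp)⟩
      · refine ⟨-(z + 1), Or.inl ?_⟩
        have := hconj (z + 1)
        rw [add_comm, zpow_add] at this
        simp only [zpow_one, mul_assoc, s_mul_cancel_left] at this
        rw [← mul_assoc, this, add_comm 1 z]; simp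
    | inv_mul_cancel x hx y _ ih =>
      obtain ⟨z, rfl | rfl⟩ := ih <;> rcases hx with rfl | rfl <;> rw [s_inv]
      · exact ⟨-z, Or.inr (hconj z)⟩
      · refine ⟨-(z + 1), Or.inr ?_⟩
        rw [← hconj, add_comm, zpow_add]; simp [mul_assoc]
      · exact ⟨-z, Or.inl (by rw [← mul_assoc, hconj]; simp)⟩
      · refine ⟨-(z + 1), Or.inl ?_⟩
        have := hconj (z + 1)
        rw [add_comm, zpow_add] at this
        simp only [zpow_one, mul_assoc, s_mul_cancel_left] at this
        rw [← mul_assoc, this, add_comm 1 z]; simp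
  obtain ⟨z, rfl | rfl⟩ := h2
  · rw [mul_comm 2, pow_mul, ← zpow_natCast ((R.s a * R.s b) ^ z) n, zpow_comm, zpow_natCast, h1]
    simp
  · have hconj : (R.s a * R.s b) ^ z * R.s a * ((R.s a * R.s b) ^ z * R.s a) = 1 := by
      have := conj_zpow (a := R.s a) (b := R.s a * R.s b) (i := z)
      rw [s_inv, show R.s a * (R.s a * R.s b) * R.s a = (R.s a * R.s b)⁻¹ by simp] at this
      rw [show (R.s a * R.s b) ^ z * R.s a * ((R.s a * R.s b) ^ z * R.s a) =
        (R.s a * R.s b) ^ z * (R.s a * (R.s a * R.s b) ^ z * R.s a) by simp only [mul_assoc],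
        ← this, inv_zpow, mul_inv_cancel]
    rw [pow_mul, pow_two, hconj, one_pow]

lemma len_le (l : List B) : R.len (R.wordProd l) ≤ l.length := Nat.sInf_le ⟨l, rfl, rfl⟩

lemma exists_word (l : List B) :
    ∃ m : List B, R.wordProd m = R.wordProd l ∧ m.length = R.len (R.wordProd l) := by
  obtain ⟨m, h1, h2⟩ := Nat.sInf_mem (s := {n | ∃ m : List B, m.length = n ∧
    (m.map R.s).prod = R.wordProd l}) ⟨_, l, rfl, rfl⟩
  exact ⟨m, h2, h1⟩

lemma reduced_iff (l : List B) : R.Reduced l ↔ R.len (R.wordProd l) = l.length := by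
  constructor
  · intro h
    obtain ⟨m, h1, h2⟩ := R.exists_word l
    exact le_antisymm (R.len_le l) (h2 ▸ h m h1)
  · intro h l' hl'
    rw [← h, ← hl']
    exact R.len_le l'

lemma len_mul_s_of_pos {x : G} {l : List B} (hx : R.wordProd l = x) {k : B}
    (h : R.pos (R.act x (R.simple k))) : R.len (x * R.s k) = R.len x + 1 := by
  obtain ⟨m, hm, hlm⟩ := R.exists_word l
  obtain ⟨m', hm', hlm'⟩ := R.exists_word (l ++ [k])
  rw [hx] at hm hlm
  simp only [wordProd_append, hx, wordProd_cons, wordProd_nil, mul_one] at hm' hlm'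
  apply le_antisymm
  · have := R.len_le (m ++ [k])
    simpa [hm, hlm] using this
  · obtain ⟨w, hw⟩ := R.exists_mem_inv m' _ (R.simple_pos k) (by
      rw [hm', act_mul, act_s_simple, R.act_neg, R.pos_neg, not_not]; exact h)
    obtain ⟨h1, h2⟩ := R.inv_spec _ _ _ hw
    have h3 := R.len_le w
    rw [h1, hm'] at h3
    change R.len (_ * R.s k * R.s k) ≤ _ at h3
    rw [s_mul_cancel_right] at h3
    omega

lemma len_mul_refl_of_neg {x : G} {l : List B} (hx : R.wordProd l = x) {r : Φ} (hr : R.pos r)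
    (h : ¬ R.pos (R.act x r)) : R.len (x * R.refl r) < R.len x := by
  obtain ⟨m, hm, hlm⟩ := R.exists_word l
  rw [hx] at hm hlm
  obtain ⟨w, hw⟩ := R.exists_mem_inv m r hr (by rwa [hm])
  obtain ⟨h1, h2⟩ := R.inv_spec _ _ _ hw
  have h3 := R.len_le w
  rw [h1, hm] at h3
  omega

lemma len_mul_refl_of_pos {x : G} {l' : List B} {r : Φ} (hr : R.pos r)
    (hx' : R.wordProd l' = x * R.refl r)
    (h : R.pos (R.act x r)) : R.len x < R.len (x * R.refl r) := by
  have := R.len_mul_refl_of_neg hx' hr (by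
    rw [act_mul, R.act_refl_self, R.act_neg, R.pos_neg, not_not]; exact h)
  rwa [mul_assoc, R.refl_mul_self, mul_one] at this

/-- The length is the number of inversions. -/
lemma len_eq_ncard {x : G} {l : List B} (hx : R.wordProd l = x) :
    R.len x = {r | R.pos r ∧ ¬ R.pos (R.act x r)}.ncard := by
  classical
  obtain ⟨m, hm, hlm⟩ := R.exists_word l
  have hred : R.Reduced m := by rw [reduced_iff, hm, hlm]
  rw [hx] at hm hlm
  rw [← hlm, ← R.length_inv m, ← List.length_map (f := Prod.fst),
    ← List.toFinset_card_of_nodup (R.nodup_inv hred), ← Set.ncard_coe_finset]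
  congr 1
  ext r
  rw [Finset.mem_coe, List.mem_toFinset, R.mem_inv_iff hred, hm]
  rfl

lemma eq_one_of_pos {x : G} {l : List B} (hx : R.wordProd l = x)
    (h : ∀ k, R.pos (R.act x (R.simple k))) : x = 1 := by
  obtain ⟨m, hm, hlm⟩ := R.exists_word l
  rcases List.eq_nil_or_concat m with rfl | ⟨m', k, rfl⟩
  · rw [← hx, ← hm]; rfl
  · exfalso
    have h1 := R.len_mul_s_of_pos hx (h k)
    have h2 := R.len_le m'
    rw [hx] at hm hlm
    simp only [List.concat_eq_append, wordProd_append, wordProd_cons, wordProd_nil, mul_one] at hm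
    rw [← hm, s_mul_cancel_right] at h1
    simp [← hm] at hlm
    omega

end ReflSys

/-! ### Nil-Hecke elements of a reflection system -/

/-- The data needed to form nil-Hecke elements for a reflection system: an action of the group on a
field `F`, the nonzero values `c k` in `F` of the simple roots, and a set `L` of "weights" with values
`wt` in `F`, on which the coroots take integral values `pair`. The last condition says that the group
elements fixing all weights behave like translations. -/
structure NilHeckeDatum {G Φ B : Type*} [Group G] (R : ReflSys G Φ B) (F : Type*) [Field F]
    [MulSemiringAction G F] (L : Type*) where
  /-- The value of a weight in the field. -/
  wt : L → F
  /-- The action of the group on weights. -/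
  actL : G → L → L
  /-- The value of the coroot attached to a root on a weight. -/
  pair : Φ → L → ℤ
  /-- The value of a simple root in the field. -/
  c : B → F
  wt_actL : ∀ g x, wt (actL g x) = g • wt x
  pair_act : ∀ g r x, pair (R.act g r) (actL g x) = pair r x
  c_ne_zero : ∀ k, c k ≠ 0
  s_smul_c : ∀ k, R.s k • c k = -c k
  wt_sub : ∀ k x, wt x - R.s k • wt x = pair (R.simple k) x * c k
  eq_one_of_fixed : ∀ (g : G) (n : ℕ), (∀ x, g • wt x = wt x) → 0 < n → g ^ n = 1 → g = 1

namespace NilHeckeDatum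

open SkewMonoidAlgebra

variable {G Φ B F L : Type*} [Group G] [Field F] [MulSemiringAction G F] {R : ReflSys G Φ B}
  (D : NilHeckeDatum R F L)

/-- The nil-Hecke element `c⁻¹ (1 - δ_s)` of a simple reflection. -/
noncomputable def gen (k : B) : SkewMonoidAlgebra F G :=
  (D.c k)⁻¹ • (1 - SkewMonoidAlgebra.of F G (R.s k))

/-- The product of the nil-Hecke elements of the letters of a word. -/
noncomputable def word (l : List B) : SkewMonoidAlgebra F G := (l.map D.gen).prod

@[simp] lemma word_nil : D.word [] = 1 := rfl

@[simp] lemma word_cons (k : B) (l : List B) : D.word (k :: l) = D.gen k * D.word l := by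
  simp [word]

@[simp] lemma word_append (l m : List B) : D.word (l ++ m) = D.word l * D.word m := by
  simp [word]

lemma gen_eq (k : B) : D.gen k = single 1 (D.c k)⁻¹ - single (R.s k) (D.c k)⁻¹ := by
  rw [gen, smul_sub, smul_of, one_def, smul_single, smul_eq_mul, mul_one]

lemma gen_mul_wt (k : B) (x : L) : D.gen k * single 1 (D.wt x) =
    single 1 (R.s k • D.wt x) * D.gen k + D.pair (R.simple k) x • (1 : SkewMonoidAlgebra F G) := by
  rw [gen_eq, sub_mul, mul_sub]
  simp only [single_mul_single, one_smul, mul_one, one_mul]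
  have h := D.wt_sub k x
  rw [mul_comm (R.s k • D.wt x) (D.c k)⁻¹, sub_add_eq_add_sub, sub_left_inj, one_def,
    ← Int.cast_smul_eq_zsmul F, smul_single, ← single_add]
  congr 1
  have := D.c_ne_zero k
  field_simp
  rw [smul_eq_mul, mul_one]
  linear_combination h

lemma gen_mul_self (k : B) : D.gen k * D.gen k = 0 := by
  rw [gen_eq, sub_mul, mul_sub, mul_sub]
  simp only [single_mul_single, one_smul, mul_one, one_mul, smul_inv'', D.s_smul_c,
    R.s_mul_self]
  simp [single_neg, inv_neg]
  abel

/-- The commutation relation between a product of nil-Hecke generators and a weight. -/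
lemma word_mul_wt (l : List B) (x : L) : D.word l * single 1 (D.wt x) =
    single 1 (R.wordProd l • D.wt x) * D.word l +
      ((R.inv l).map fun p => D.pair p.1 x • D.word p.2).sum := by
  induction l with
  | nil => simp [ReflSys.inv]
  | cons k l ih =>
    have h1 : D.gen k * single 1 (R.wordProd l • D.wt x) =
        single 1 (R.wordProd (k :: l) • D.wt x) * D.gen k +
          D.pair (R.act (R.wordProd l)⁻¹ (R.simple k)) x • 1 := by
      have h2 := D.pair_act (R.wordProd l) (R.act (R.wordProd l)⁻¹ (R.simple k)) x
      rw [R.act_act_inv] at h2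
      rw [← h2, ← D.wt_actL, D.gen_mul_wt, D.wt_actL, R.wordProd_cons, mul_smul]
    rw [word_cons, mul_assoc, ih, mul_add, ← mul_assoc, h1, add_mul, mul_assoc, ReflSys.inv,
      List.map_cons, List.sum_cons, List.map_map, add_assoc]
    congr 2
    · rw [smul_mul_assoc, one_mul]
    · rw [← List.sum_map_mul_left]
      simp only [Function.comp_def, mul_smul_comm, word_cons]

/-- The sum of the coefficients. It kills every right multiple of a generator. -/
noncomputable def aug : SkewMonoidAlgebra F G →+ F where
  toFun a := a.sum fun _ c => c
  map_zero' := by simp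
  map_add' a b := SkewMonoidAlgebra.sum_add_index' (by simp) (by simp)

@[simp] lemma aug_single (g : G) (c : F) : aug (single g c) = c := by
  simp [aug]

lemma aug_mul_gen (a : SkewMonoidAlgebra F G) (k : B) : aug (a * D.gen k) = 0 := by
  induction a using SkewMonoidAlgebra.induction_on with
  | zero => simp
  | single g c => simp [gen_eq, mul_sub, single_mul_single]
  | add a b ha hb => rw [add_mul, map_add, ha, hb, add_zero]

lemma aug_word {l : List B} (h : l ≠ []) : aug (D.word l) = 0 := by
  obtain ⟨l, k, rfl⟩ := (List.eq_nil_or_concat l).resolve_left h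
  rw [List.concat_eq_append, word_append, word_cons, word_nil, mul_one]
  exact D.aug_mul_gen _ _

lemma gen_coeff_mem {H : Subgroup G} {k : B} (hk : R.s k ∈ H) {g : G}
    (hg : (D.gen k).coeff g ≠ 0) : g ∈ H := by
  classical
  rw [gen_eq] at hg
  by_contra hH
  have h1 : (1 : G) ≠ g := fun h => hH (h ▸ one_mem _)
  have h2 : R.s k ≠ g := fun h => hH (h ▸ hk)
  simp [h1, h2] at hg

lemma word_coeff_mem {H : Subgroup G} {l : List B} (hl : ∀ k ∈ l, R.s k ∈ H) {g : G}
    (hg : (D.word l).coeff g ≠ 0) : g ∈ H := by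
  classical
  induction l generalizing g with
  | nil =>
    rw [word_nil, one_def, coeff_single_apply] at hg
    by_cases h : (1 : G) = g
    · exact h ▸ one_mem _
    · simp [h] at hg
  | cons k l ih =>
    rw [← mem_support_iff, word_cons] at hg
    obtain ⟨x, hx, y, hy, rfl⟩ := Finset.mem_mul.1 (SkewMonoidAlgebra.support_mul _ _ hg)
    exact mul_mem (D.gen_coeff_mem (hl k (by simp)) (mem_support_iff.1 hx))
      (ih (fun k hk => hl k (by simp [hk])) (mem_support_iff.1 hy))

/-- The braid relations. Both alternating products satisfy the same commutation relation with
weights, up to terms that agree by hypothesis. So their difference is supported on elements that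
act as `x` does on weights; as the support lies in a finite dihedral group, the difference is
a multiple of `δ_x`. The sum of its coefficients is zero, so it vanishes. -/
lemma word_alt_eq {a b : B} {n : ℕ}
    (h : R.wordProd (ReflSys.alt a b (n + 1)) = R.wordProd (ReflSys.alt b a (n + 1)))
    (hcomm : ∀ x, (D.word (ReflSys.alt a b (n + 1)) - D.word (ReflSys.alt b a (n + 1))) *
      single 1 (D.wt x) = single 1 (R.wordProd (ReflSys.alt a b (n + 1)) • D.wt x) *
      (D.word (ReflSys.alt a b (n + 1)) - D.word (ReflSys.alt b a (n + 1)))) :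
    D.word (ReflSys.alt a b (n + 1)) = D.word (ReflSys.alt b a (n + 1)) := by
  classical
  set H : Subgroup G := Subgroup.closure {R.s a, R.s b} with hH
  have hmem : ∀ (a b : B) (n : ℕ), R.s a ∈ H → R.s b ∈ H → ∀ k ∈ ReflSys.alt a b n, R.s k ∈ H := by
    intro a b n
    induction n generalizing a b with
    | zero => simp [ReflSys.alt]
    | succ n ih =>
      intro ha hb k hk
      rcases List.mem_cons.1 hk with rfl | hk
      · exact ha
      · exact ih b a hb ha k hk
  have ha : R.s a ∈ H := Subgroup.subset_closure (by simp)
  have hb : R.s b ∈ H := Subgroup.subset_closure (by simp)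
  have hxH : R.wordProd (ReflSys.alt a b (n + 1)) ∈ H := by
    refine Subgroup.list_prod_mem _ fun y hy => ?_
    obtain ⟨k, hk, rfl⟩ := List.mem_map.1 hy
    exact hmem a b _ ha hb k hk
  set x := R.wordProd (ReflSys.alt a b (n + 1)) with hx
  set E := D.word (ReflSys.alt a b (n + 1)) - D.word (ReflSys.alt b a (n + 1)) with hE
  have hsupp : ∀ z, z ≠ x → E.coeff z = 0 := by
    intro z hz
    by_contra hne
    have hzH : z ∈ H := by
      by_contra hzH
      refine hne ?_
      rw [hE, coeff_sub, Finsupp.sub_apply, sub_eq_zero]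
      trans 0
      · by_contra h0
        exact hzH (D.word_coeff_mem (hmem a b _ ha hb) h0)
      · symm
        by_contra h0
        exact hzH (D.word_coeff_mem (hmem b a _ hb ha) h0)
    refine hz (inv_mul_eq_one.1 ?_).symm
    refine D.eq_one_of_fixed _ (2 * (n + 1)) (fun y => ?_) (by omega)
      (R.pow_eq_one_of_alt h _ (mul_mem (inv_mem hxH) hzH))
    have h1 := congrArg (fun f => f.coeff z) (hcomm y)
    simp only [coeff_mul_single_one, coeff_single_one_mul] at h1
    rw [mul_smul, inv_smul_eq_iff]
    rw [mul_comm] at h1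
    exact mul_right_cancel₀ hne h1
  have hEs : E = single x (E.coeff x) := by
    ext z
    rw [coeff_single_apply]
    split_ifs with hz
    · rw [hz]
    · exact hsupp z (Ne.symm hz)
  have h0 : E.coeff x = 0 := by
    rw [← aug_single x (E.coeff x), ← hEs, hE, map_sub, D.aug_word (by simp [ReflSys.alt]),
      D.aug_word (by simp [ReflSys.alt]), sub_zero]
  rw [h0, single_zero] at hEs
  exact sub_eq_zero.1 hEs

/-- The product along a word that is not reduced vanishes, provided that products along shorter
reduced words depend only on the element. -/
lemma word_eq_zero_of_forall {N : ℕ}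
    (IH : ∀ l l' : List B, l.length < N → R.Reduced l → R.Reduced l' →
      R.wordProd l = R.wordProd l' → D.word l = D.word l') (l : List B) (hN : l.length ≤ N)
    (h : ¬ R.Reduced l) : D.word l = 0 := by
  induction l with
  | nil => exact absurd (fun _ _ => Nat.zero_le _) h
  | cons k l ih =>
    by_cases hl : R.Reduced l
    · have hk : ¬ R.pos (R.act (R.wordProd l)⁻¹ (R.simple k)) := fun hk =>
        h (R.reduced_cons hl hk)
      obtain ⟨-, m, -, hm, hlen⟩ := R.exists_left_exchange l k hk
      have hr : R.Reduced (k :: m) := hl.congr hm.symm (by simp; omega)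
      rw [word_cons, IH l _ (by simp at hN; omega) hl hr hm, word_cons, ← mul_assoc,
        gen_mul_self, zero_mul]
    · rw [word_cons, ih (by simp at hN; omega) hl, mul_zero]

/-- The lower terms of the commutation relation with a weight depend only on the element, provided
that products along shorter reduced words do. -/
lemma lower_terms_eq {n : ℕ}
    (IH : ∀ l l' : List B, l.length < n → R.Reduced l → R.Reduced l' →
      R.wordProd l = R.wordProd l' → D.word l = D.word l') {l l' : List B} (hl : R.Reduced l)
    (hl' : R.Reduced l') (hn : l.length = n) (h : R.wordProd l = R.wordProd l') (x : L) :
    ((R.inv l).map fun p => D.pair p.1 x • D.word p.2).sum =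
      ((R.inv l').map fun p => D.pair p.1 x • D.word p.2).sum := by
  classical
  have hlen : l'.length = n := by
    rw [← hn]; exact le_antisymm (hl' l h) (hl l' h.symm)
  -- the word left after deleting a letter is determined by the element it spells
  let val : G → SkewMonoidAlgebra F G := fun z =>
    if hz : ∃ m, R.Reduced m ∧ R.wordProd m = z ∧ m.length + 1 = n then D.word hz.choose else 0
  have key : ∀ m : List B, m.length + 1 = n → D.word m = val (R.wordProd m) := by
    intro m hm
    by_cases hz : ∃ m', R.Reduced m' ∧ R.wordProd m' = R.wordProd m ∧ m'.length + 1 = n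
    · simp only [val, dif_pos hz]
      obtain ⟨h1, h2, h3⟩ := hz.choose_spec
      exact IH _ _ (by omega) (h1.congr h2.symm (by omega)) h1 h2.symm
    · simp only [val, dif_neg hz]
      refine D.word_eq_zero_of_forall (N := n) IH m (by omega) fun hr => hz ⟨m, hr, rfl, hm⟩
  have key' : ∀ l : List B, l.length = n →
      ((R.inv l).map fun p => D.pair p.1 x • D.word p.2) =
      (((R.inv l).map Prod.fst).map fun r => D.pair r x • val (R.wordProd l * R.refl r)) := by
    intro l hl
    rw [List.map_map]
    refine List.map_congr_left fun p hp => ?_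
    obtain ⟨h1, h2⟩ := R.inv_spec l p.1 p.2 hp
    rw [Function.comp_apply, key p.2 (by omega), h1]
  rw [key' l hn, key' l' hlen, h]
  refine List.Perm.sum_eq (List.Perm.map _ ?_)
  rw [List.perm_ext_iff_of_nodup (R.nodup_inv hl) (R.nodup_inv hl')]
  intro r
  rw [R.mem_inv_iff hl, R.mem_inv_iff hl', h]

/-- The product of nil-Hecke generators along a reduced word depends only on the element. -/
theorem word_eq_word {l l' : List B} (hl : R.Reduced l) (hl' : R.Reduced l')
    (h : R.wordProd l = R.wordProd l') : D.word l = D.word l' := by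
  induction hn : l.length using Nat.strong_induction_on generalizing l l' with
  | _ n IH =>
  have hlen : l'.length = n := by
    rw [← hn]; exact le_antisymm (hl' l h) (hl l' h.symm)
  rcases l with _ | ⟨a, l⟩
  · obtain rfl : l' = [] := by rw [← List.length_eq_zero_iff, hlen, ← hn]; rfl
    rfl
  rcases l' with _ | ⟨b, l'⟩
  · rw [List.length_nil] at hlen
    rw [← hlen] at hn
    simp at hn
  obtain ⟨k, m, h1, h2, h3⟩ := R.exists_alt hl hl' h
  have hr1 : R.Reduced (ReflSys.alt a b (k + 1) ++ m) := hl.congr h1 (by simp; simp at h3; omega)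
  have hr2 : R.Reduced (ReflSys.alt b a (k + 1) ++ m) := hl.congr h2 (by simp; simp at h3; omega)
  have e1 : D.word (a :: l) = D.word (ReflSys.alt a b (k + 1) ++ m) := by
    have h4 : R.s a * R.wordProd (ReflSys.alt b a k ++ m) = R.s a * R.wordProd l := by
      rw [← R.wordProd_cons, ← R.wordProd_cons]; exact h1
    change _ = D.word (a :: (ReflSys.alt b a k ++ m))
    rw [word_cons, word_cons, IH l.length (by simp at hn; omega) hl.tail hr1.tail
      (mul_left_cancel h4).symm rfl]
    rfl
  have e2 : D.word (b :: l') = D.word (ReflSys.alt b a (k + 1) ++ m) := by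
    have h4 : R.s b * R.wordProd (ReflSys.alt a b k ++ m) = R.s b * R.wordProd l' := by
      rw [← R.wordProd_cons, ← R.wordProd_cons, ← h]; exact h2
    change _ = D.word (b :: (ReflSys.alt a b k ++ m))
    rw [word_cons, word_cons, IH l'.length (by simp at hlen; omega) hl'.tail hr2.tail
      (mul_left_cancel h4).symm rfl]
    rfl
  have hprod : R.wordProd (ReflSys.alt a b (k + 1)) = R.wordProd (ReflSys.alt b a (k + 1)) := by
    have := h1.trans h2.symm
    rwa [R.wordProd_append, R.wordProd_append, mul_left_inj] at this
  rw [e1, e2, word_append, word_append]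
  congr 1
  rcases m with _ | ⟨c, m⟩
  · refine D.word_alt_eq hprod fun x => ?_
    rw [List.append_nil] at hr1 hr2
    rw [sub_mul, mul_sub, D.word_mul_wt, D.word_mul_wt, hprod,
      D.lower_terms_eq (n := k + 1) (fun l l' hl h1 h2 h4 => IH l.length
        (by rw [List.length_nil] at h3; omega) h1 h2 h4 rfl) hr1 hr2 (by simp) hprod x]
    abel
  · exact IH (k + 1) (by rw [List.length_cons] at h3; omega) hr1.of_append_left hr2.of_append_left hprod
      (by simp)

lemma word_eq_zero {l : List B} (h : ¬ R.Reduced l) : D.word l = 0 :=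
  D.word_eq_zero_of_forall (fun _ _ _ h1 h2 h3 => D.word_eq_word h1 h2 h3) l le_rfl h

/-- The nil-Hecke element `A_x`. -/
noncomputable def elt (x : G) : SkewMonoidAlgebra F G :=
  D.word (Classical.epsilon fun l => R.wordProd l = x ∧ l.length = R.len x)

lemma elt_eq {l : List B} (h : R.Reduced l) : D.elt (R.wordProd l) = D.word l := by
  have := Classical.epsilon_spec (p := fun m => R.wordProd m = R.wordProd l ∧
    m.length = R.len (R.wordProd l)) (R.exists_word l)
  refine D.word_eq_word ?_ h this.1
  rw [R.reduced_iff, this.1, this.2]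

/-- The commutation relation between `A_x` and weights, the sum being over a finite set `T` of
inversions of `x`. The term of an inversion `r` vanishes if `x s_r` is too short. -/
lemma elt_mul_wt {l : List B} {x : G} (hx : R.wordProd l = x) (T : Finset Φ)
    (hT : ∀ r, r ∈ T ↔ R.pos r ∧ ¬ R.pos (R.act x r)) (y : L) :
    D.elt x * single 1 (D.wt y) = single 1 (x • D.wt y) * D.elt x +
      ∑ r ∈ T, D.pair r y • (if R.len (x * R.refl r) + 1 = R.len x then D.elt (x * R.refl r)
        else 0) := by
  classical
  obtain ⟨m, hm, hlm⟩ := R.exists_word l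
  have hred : R.Reduced m := by rw [R.reduced_iff, hm, hlm]
  rw [hx] at hm hlm
  have h := D.word_mul_wt m y
  rw [← D.elt_eq hred, hm] at h
  rw [h]
  congr 1
  have hTeq : T = ((R.inv m).map Prod.fst).toFinset := by
    ext r; rw [hT, List.mem_toFinset, R.mem_inv_iff hred, hm]
  rw [hTeq, List.sum_toFinset _ (R.nodup_inv hred), List.map_map]
  refine congrArg List.sum (List.map_congr_left fun p hp => ?_)
  obtain ⟨h1, h2⟩ := R.inv_spec m p.1 p.2 hp
  rw [Function.comp_apply, ← hm, ← h1, hm, ← hlm, ← h2]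
  congr 1
  split_ifs with h3
  · exact (D.elt_eq ((R.reduced_iff _).2 (by omega))).symm
  · exact D.word_eq_zero fun hr => h3 (by rw [(R.reduced_iff _).1 hr])

end NilHeckeDatum

end AffineGrassmannian

noncomputable section

namespace AffineGrassmannian

/-! ### The Weyl group acting on roots, weights and coweights -/

section WeylAction

variable {ι K M N : Type*} [Field K] [AddCommGroup M] [Module K M] [AddCommGroup N] [Module K N]
variable (P : RootPairing ι K M N)

/-- The action of the Weyl group on the indices of the roots. -/
def perm : P.weylGroup →* Equiv.Perm ι :=
  (RootPairing.Equiv.indexHom P).comp P.weylGroup.subtype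

/-- The index of the negative of a root. -/
def negIdx (k : ι) : ι := P.reflectionPerm k k

lemma root_negIdx (k : ι) : P.root (negIdx P k) = -P.root k := by
  rw [negIdx, RootPairing.root_reflectionPerm, RootPairing.reflection_apply_self]

lemma coroot_negIdx (k : ι) : P.coroot (negIdx P k) = -P.coroot k := by
  rw [negIdx, RootPairing.coroot_reflectionPerm, RootPairing.coreflection_apply_self]

lemma root_perm (w : P.weylGroup) (k : ι) : P.root (perm P w k) = (w : P.Aut) • P.root k :=
  (aut_smul_root P w k).symm

lemma root_perm_ofIdx (k l : ι) : P.root (perm P (RootPairing.weylGroup.ofIdx P k) l) =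
    P.root l - P.pairing l k • P.root k := by
  change P.root (P.reflectionPerm k l) = _
  rw [← P.reflectionPerm_root]; rfl

lemma perm_mul (v w : P.weylGroup) (k : ι) : perm P (v * w) k = perm P v (perm P w k) := by
  rw [map_mul]; rfl

@[simp] lemma perm_inv_perm (w : P.weylGroup) (k : ι) : perm P w⁻¹ (perm P w k) = k := by
  rw [← perm_mul]; simp

@[simp] lemma perm_perm_inv (w : P.weylGroup) (k : ι) : perm P w (perm P w⁻¹ k) = k := by
  rw [← perm_mul]; simp

@[simp] lemma perm_one (k : ι) : perm P 1 k = k := by simp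

lemma perm_neg (w : P.weylGroup) (k : ι) : perm P w (negIdx P k) = negIdx P (perm P w k) := by
  apply P.root.injective
  rw [root_perm, root_negIdx, root_negIdx, root_perm, smul_neg]

@[simp] lemma negIdx_negIdx (k : ι) : negIdx P (negIdx P k) = k := by
  apply P.root.injective
  rw [root_negIdx, root_negIdx, neg_neg]

lemma negIdx_involutive : Function.Involutive (negIdx P) := negIdx_negIdx P

lemma perm_injective [P.IsRootSystem] : Function.Injective (perm P) := by
  intro v w h
  refine Subtype.ext (RootPairing.Equiv.weightHom_injective P (LinearEquiv.toLinearMap_injective ?_))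
  refine LinearMap.ext_on_range (v := P.root) RootPairing.IsRootSystem.span_root_eq_top fun k => ?_
  change (v : P.Aut) • P.root k = (w : P.Aut) • P.root k
  rw [← root_perm, ← root_perm, h]

lemma coroot_perm (w : P.weylGroup) (k : ι) :
    P.coroot (perm P w k) = MulOpposite.op (w : P.Aut)⁻¹ • P.coroot k := by
  rw [op_aut_smul_coroot]; rfl

lemma pairing_perm (w : P.weylGroup) (k l : ι) :
    P.pairing (perm P w k) (perm P w l) = P.pairing k l := by
  change P.toLinearMap (P.root _) (P.coroot _) = P.toLinearMap (P.root _) (P.coroot _)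
  rw [root_perm, coroot_perm, pairing_smul, ← mul_smul, ← MulOpposite.op_mul]
  simp

lemma ofIdx_perm [P.IsRootSystem] (w : P.weylGroup) (k : ι) :
    RootPairing.weylGroup.ofIdx P (perm P w k) = w * RootPairing.weylGroup.ofIdx P k * w⁻¹ := by
  apply perm_injective P
  ext l
  apply P.root.injective
  rw [perm_mul, perm_mul, root_perm_ofIdx, root_perm P w (perm P _ _), root_perm_ofIdx, smul_sub,
    ← root_perm, perm_perm_inv, smul_comm, ← root_perm, ← pairing_perm P w (perm P w⁻¹ l) k,
    perm_perm_inv]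

lemma ofIdx_mul_self (k : ι) :
    RootPairing.weylGroup.ofIdx P k * RootPairing.weylGroup.ofIdx P k = 1 := by
  apply Subtype.ext
  have := RootPairing.Equiv.reflection_inv P k
  rw [inv_eq_iff_mul_eq_one] at this
  exact this

lemma ofIdx_negIdx [P.IsRootSystem] (k : ι) :
    RootPairing.weylGroup.ofIdx P (negIdx P k) = RootPairing.weylGroup.ofIdx P k := by
  have h := ofIdx_perm P (RootPairing.weylGroup.ofIdx P k) k
  rwa [ofIdx_mul_self, one_mul, inv_eq_of_mul_eq_one_left (ofIdx_mul_self P k)] at h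

/-- The integer `⟨β, y⟩`, for a root `β` and a coweight `y`. -/
def ip (k : ι) (y : coweightLattice P) : ℤ := (y.2 k).choose

lemma ip_spec (k : ι) (y : coweightLattice P) :
    P.toLinearMap (P.root k) (y : N) = (ip P k y : K) := (y.2 k).choose_spec

/-- The integer `⟨x, β^∨⟩`, for a weight `x` and a root `β`. -/
def wp (k : ι) (x : weightLattice P) : ℤ := (x.2 k).choose

lemma wp_spec (k : ι) (x : weightLattice P) :
    P.toLinearMap (x : M) (P.coroot k) = (wp P k x : K) := (x.2 k).choose_spec

lemma coe_smul_coweight (w : P.weylGroup) (y : coweightLattice P) :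
    ((w • y : coweightLattice P) : N) = MulOpposite.op (w : P.Aut)⁻¹ • (y : N) := rfl

lemma coe_smul_weight (w : P.weylGroup) (x : weightLattice P) :
    ((w • x : weightLattice P) : M) = (w : P.Aut) • (x : M) := rfl

variable [CharZero K]

lemma ip_eq_iff {k : ι} {y : coweightLattice P} {n : ℤ} :
    ip P k y = n ↔ P.toLinearMap (P.root k) (y : N) = n := by
  rw [ip_spec]; exact Int.cast_inj.symm

lemma wp_eq_iff {k : ι} {x : weightLattice P} {n : ℤ} :
    wp P k x = n ↔ P.toLinearMap (x : M) (P.coroot k) = n := by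
  rw [wp_spec]; exact Int.cast_inj.symm

lemma ip_perm (w : P.weylGroup) (k : ι) (y : coweightLattice P) :
    ip P (perm P w k) (w • y) = ip P k y := by
  rw [ip_eq_iff, ← ip_spec, root_perm, coe_smul_coweight, pairing_smul, ← mul_smul,
    ← MulOpposite.op_mul]
  simp

lemma ip_smul (w : P.weylGroup) (k : ι) (y : coweightLattice P) :
    ip P k (w • y) = ip P (perm P w⁻¹ k) y := by
  rw [← ip_perm P w (perm P w⁻¹ k), perm_perm_inv]

lemma wp_perm (w : P.weylGroup) (k : ι) (x : weightLattice P) :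
    wp P (perm P w k) (w • x) = wp P k x := by
  rw [wp_eq_iff, ← wp_spec, coroot_perm, coe_smul_weight, pairing_smul, ← mul_smul,
    ← MulOpposite.op_mul]
  simp

lemma ip_add (k : ι) (y z : coweightLattice P) : ip P k (y + z) = ip P k y + ip P k z := by
  rw [ip_eq_iff, AddSubgroup.coe_add, map_add, ip_spec, ip_spec, Int.cast_add]

lemma ip_neg (k : ι) (y : coweightLattice P) : ip P k (-y) = -ip P k y := by
  rw [ip_eq_iff, AddSubgroup.coe_neg, map_neg, ip_spec, Int.cast_neg]

@[simp] lemma ip_zero (k : ι) : ip P k 0 = 0 := by simp [ip_eq_iff]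

lemma ip_zsmul (k : ι) (n : ℤ) (y : coweightLattice P) : ip P k (n • y) = n * ip P k y := by
  rw [ip_eq_iff, AddSubgroup.coe_zsmul, map_zsmul, ip_spec]; simp

lemma ip_negIdx (k : ι) (y : coweightLattice P) : ip P (negIdx P k) y = -ip P k y := by
  rw [ip_eq_iff, root_negIdx, map_neg, LinearMap.neg_apply, ip_spec, Int.cast_neg]

lemma wp_negIdx (k : ι) (x : weightLattice P) : wp P (negIdx P k) x = -wp P k x := by
  rw [wp_eq_iff, coroot_negIdx, map_neg, wp_spec, Int.cast_neg]

lemma coweight_ext [P.IsRootSystem] {y z : coweightLattice P} (h : ∀ k, ip P k y = ip P k z) :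
    y = z := by
  apply Subtype.ext
  rw [← sub_eq_zero]
  refine (P.flip.eq_zero_iff_forall_coroot'_eq_zero).2 fun k => ?_
  change P.toLinearMap (P.root k) ((y : N) - z) = 0
  rw [map_sub, ip_spec, ip_spec, h, sub_self]

lemma weight_ext [P.IsRootSystem] {x y : weightLattice P} (h : ∀ k, wp P k x = wp P k y) :
    x = y := by
  apply Subtype.ext
  rw [← sub_eq_zero]
  refine (P.eq_zero_iff_forall_coroot'_eq_zero).2 fun k => ?_
  change P.toLinearMap ((x : M) - y) (P.coroot k) = 0
  rw [map_sub, LinearMap.sub_apply, wp_spec, wp_spec, h, sub_self]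

variable [P.IsCrystallographic]

/-- A coroot as an element of the coweight lattice. -/
def corootC (k : ι) : coweightLattice P := ⟨P.coroot k, coroot_mem_coweightLattice P k⟩

/-- A root as an element of the weight lattice. -/
def rootW (k : ι) : weightLattice P := ⟨P.root k, root_mem_weightLattice P k⟩

lemma smul_corootC (w : P.weylGroup) (k : ι) : w • corootC P k = corootC P (perm P w k) :=
  Subtype.ext (coroot_perm P w k).symm

lemma smul_rootW (w : P.weylGroup) (k : ι) : w • rootW P k = rootW P (perm P w k) :=
  Subtype.ext (root_perm P w k).symm

lemma smul_zsmul_coweight (w : P.weylGroup) (n : ℤ) (y : coweightLattice P) :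
    w • n • y = n • w • y :=
  map_zsmul (DistribSMul.toAddMonoidHom (coweightLattice P) w) n y

lemma corootC_negIdx (k : ι) : corootC P (negIdx P k) = -corootC P k :=
  Subtype.ext (coroot_negIdx P k)

lemma rootW_negIdx (k : ι) : rootW P (negIdx P k) = -rootW P k :=
  Subtype.ext (root_negIdx P k)

lemma ip_corootC (k l : ι) : ip P k (corootC P l) = P.pairingIn ℤ k l := by
  rw [ip_eq_iff]
  exact (P.algebraMap_pairingIn ℤ k l).symm

lemma ofIdx_smul_coweight (k : ι) (y : coweightLattice P) :
    RootPairing.weylGroup.ofIdx P k • y = y - ip P k y • corootC P k := by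
  apply Subtype.ext
  rw [coe_smul_coweight, ← InvMemClass.coe_inv,
    inv_eq_of_mul_eq_one_left (ofIdx_mul_self P k)]
  change P.coreflection k (y : N) = _
  rw [RootPairing.coreflection_apply, AddSubgroup.coe_sub, AddSubgroup.coe_zsmul,
    ← Int.cast_smul_eq_zsmul K, ← ip_spec]
  rfl

lemma ofIdx_smul_weight (k : ι) (x : weightLattice P) :
    RootPairing.weylGroup.ofIdx P k • x = x - wp P k x • rootW P k := by
  apply Subtype.ext
  change P.reflection k (x : M) = _
  rw [RootPairing.reflection_apply, AddSubgroup.coe_sub, AddSubgroup.coe_zsmul,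
    ← Int.cast_smul_eq_zsmul K, ← wp_spec]
  rfl

end WeylAction

/-! ### The finite reflection system -/

section Finite

variable {ι K M N : Type*} [Field K] [AddCommGroup M] [Module K M] [AddCommGroup N] [Module K N]
  {P : RootPairing ι K M N} [Finite ι] [CharZero K] [P.IsRootSystem] [P.IsCrystallographic]
  [P.IsReduced] (b : P.Base)

lemma height_negIdx (k : ι) : b.height (negIdx P k) = -b.height k :=
  b.height_reflectionPerm_self k

lemma isPos_negIdx (k : ι) : b.IsPos (negIdx P k) ↔ ¬ b.IsPos k :=
  RootPairing.Base.IsPos.neg_iff_not b k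

/-- The Weyl group acting on the roots, as a reflection system. -/
def finSys : ReflSys P.weylGroup ι b.support where
  act := perm P
  neg := negIdx P
  pos := b.IsPos
  refl := RootPairing.weylGroup.ofIdx P
  simple := Subtype.val
  pos_neg := isPos_negIdx b
  act_neg := perm_neg P
  refl_act := ofIdx_perm P
  act_refl_self _ := rfl
  refl_mul_self := ofIdx_mul_self P
  simple_pos k := b.isPos_of_mem_support k.2
  simple_perm k _ h1 h2 := h1.reflectionPerm k.2 h2

/-- The simple reflections generate the Weyl group. -/
lemma exists_finWord (w : P.weylGroup) : ∃ l : List b.support, (finSys b).wordProd l = w := by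
  have hrefl : ∀ k : ι, ∃ l : List b.support,
      (finSys b).wordProd l = RootPairing.weylGroup.ofIdx P k := by
    intro k
    induction k using b.induction_reflect with
    | h₀ k ih =>
      obtain ⟨l, hl⟩ := ih
      refine ⟨l, ?_⟩
      rw [hl]; exact (ofIdx_negIdx P k).symm
    | h₁ k hk =>
      refine ⟨[⟨k, hk⟩], ?_⟩
      rw [ReflSys.wordProd_cons, ReflSys.wordProd_nil, mul_one]; rfl
    | h₂ k j ih hj =>
      obtain ⟨l, hl⟩ := ih
      refine ⟨⟨j, hj⟩ :: (l ++ [⟨j, hj⟩]), ?_⟩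
      rw [ReflSys.wordProd_cons, ReflSys.wordProd_append, hl, ReflSys.wordProd_cons,
        ReflSys.wordProd_nil, mul_one]
      have := ofIdx_perm P (RootPairing.weylGroup.ofIdx P j) k
      rw [inv_eq_of_mul_eq_one_left (ofIdx_mul_self P j)] at this
      exact (mul_assoc _ _ _).symm.trans this.symm
  obtain ⟨g, hg⟩ := w
  refine RootPairing.weylGroup.induction P
    (pred := fun g hg => ∃ l, (finSys b).wordProd l = ⟨g, hg⟩) (fun k => hrefl k) ⟨[], rfl⟩ ?_ hg
  rintro x y hx hy ⟨l, hl⟩ ⟨m, hm⟩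
  exact ⟨l ++ m, by rw [ReflSys.wordProd_append, hl, hm]; rfl⟩

lemma length_eq_len (w : P.weylGroup) : length b w = (finSys b).len w := rfl

lemma length_eq_ncard (w : P.weylGroup) :
    length b w = {k | b.IsPos k ∧ ¬ b.IsPos (perm P w k)}.ncard := by
  obtain ⟨l, hl⟩ := exists_finWord b w
  exact (finSys b).len_eq_ncard hl

/-- A Weyl group element preserving positivity of the simple roots is trivial. -/
lemma eq_one_of_isPos {w : P.weylGroup} (h : ∀ k : b.support, b.IsPos (perm P w k)) : w = 1 := by
  obtain ⟨l, hl⟩ := exists_finWord b w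
  exact (finSys b).eq_one_of_pos hl h

end Finite

/-! ### The extended affine Weyl group and affine roots -/

section Affine

variable {ι K M N : Type*} [Field K] [AddCommGroup M] [Module K M] [AddCommGroup N] [Module K N]
  (P : RootPairing ι K M N)

lemma wext_ext {x y : WExt P} (h1 : translPart P x = translPart P y)
    (h2 : finPart P x = finPart P y) : x = y := SemidirectProduct.ext h1 h2

@[simp] lemma translPart_transl (y : coweightLattice P) : translPart P (transl P y) = y := rfl

@[simp] lemma finPart_transl (y : coweightLattice P) : finPart P (transl P y) = 1 := rfl

@[simp] lemma translPart_fin (w : P.weylGroup) : translPart P (fin P w) = 0 := rfl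

@[simp] lemma finPart_fin (w : P.weylGroup) : finPart P (fin P w) = w := rfl

lemma finPart_mul (x y : WExt P) : finPart P (x * y) = finPart P x * finPart P y := rfl

@[simp] lemma finPart_inv (x : WExt P) : finPart P x⁻¹ = (finPart P x)⁻¹ := rfl

@[simp] lemma translPart_one : translPart P 1 = 0 := rfl

@[simp] lemma finPart_one : finPart P 1 = 1 := rfl

lemma transl_mul_transl (y z : coweightLattice P) :
    transl P y * transl P z = transl P (y + z) :=
  wext_ext P (by simp [translPart_mul]) (by simp [finPart_mul])

lemma fin_mul_transl (w : P.weylGroup) (y : coweightLattice P) :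
    fin P w * transl P y = transl P (w • y) * fin P w :=
  wext_ext P (by simp [translPart_mul]) (by simp [finPart_mul])

variable [CharZero K]

/-- The action of the extended affine Weyl group on affine roots. The pair `(β, n)` stands for
`β + n δ`, and `t_y w` sends it to `w(β) + (n - ⟨w(β), y⟩) δ`. -/
def affActFun (x : WExt P) (r : ι × ℤ) : ι × ℤ :=
  (perm P (finPart P x) r.1, r.2 - ip P (perm P (finPart P x) r.1) (translPart P x))

lemma affActFun_mul (x y : WExt P) (r : ι × ℤ) :
    affActFun P (x * y) r = affActFun P x (affActFun P y r) := by
  refine Prod.ext ?_ ?_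
  · simp [affActFun, finPart_mul]
  · simp only [affActFun, finPart_mul, translPart_mul, perm_mul, ip_add, ip_perm]
    ring

lemma affActFun_one (r : ι × ℤ) : affActFun P 1 r = r := by
  simp [affActFun]

/-- The action of the extended affine Weyl group on affine roots, by permutations. -/
def affAct : WExt P →* Equiv.Perm (ι × ℤ) where
  toFun x := ⟨affActFun P x, affActFun P x⁻¹,
    fun r => by rw [← affActFun_mul, inv_mul_cancel, affActFun_one],
    fun r => by rw [← affActFun_mul, mul_inv_cancel, affActFun_one]⟩
  map_one' := Equiv.ext (affActFun_one P)
  map_mul' x y := Equiv.ext (affActFun_mul P x y)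

lemma affAct_apply (x : WExt P) (r : ι × ℤ) : affAct P x r =
    (perm P (finPart P x) r.1, r.2 - ip P (perm P (finPart P x) r.1) (translPart P x)) := rfl

variable [P.IsCrystallographic]

/-- The reflection in an affine root. -/
def affRefl (r : ι × ℤ) : WExt P :=
  transl P (-r.2 • corootC P r.1) * fin P (RootPairing.weylGroup.ofIdx P r.1)

lemma translPart_affRefl (r : ι × ℤ) : translPart P (affRefl P r) = -r.2 • corootC P r.1 := by
  simp [affRefl, translPart_mul]

lemma finPart_affRefl (r : ι × ℤ) :
    finPart P (affRefl P r) = RootPairing.weylGroup.ofIdx P r.1 := by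
  simp [affRefl, finPart_mul]

end Affine

/-! ### The highest root -/

section HighestRoot

variable {ι K M N : Type*} [Field K] [AddCommGroup M] [Module K M] [AddCommGroup N] [Module K N]
  {P : RootPairing ι K M N} [Finite ι] [CharZero K] [P.IsRootSystem] [P.IsCrystallographic]
  [P.IsReduced] (b : P.Base)

/-- The linear form whose value at a root is the height. -/
def heightForm : M →ₗ[K] K := ∑ i : b.support, b.toWeightBasis.coord i

lemma heightForm_simple (j : b.support) : heightForm b (P.root j) = 1 := by
  rw [← b.toWeightBasis_apply j, heightForm, LinearMap.sum_apply,
    Finset.sum_eq_single j (by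
      intro i _ hij
      rw [Module.Basis.coord_apply, Module.Basis.repr_self, Finsupp.single_eq_of_ne hij])
      (by simp)]
  simp

lemma heightForm_root (k : ι) : heightForm b (P.root k) = b.height k := by
  obtain ⟨f, -, -, hf⟩ := b.exists_root_eq_sum_int k
  rw [RootPairing.Base.height_eq_sum hf, hf, map_sum, Int.cast_sum]
  refine Finset.sum_congr rfl fun j hj => ?_
  rw [map_zsmul, heightForm_simple b ⟨j, hj⟩]
  simp

lemma heightForm_of_mem_closure {x : M} (hx : x ∈ AddSubmonoid.closure (P.root '' b.support)) :
    ∃ n : ℕ, heightForm b x = n ∧ (n = 0 → x = 0) := by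
  induction hx using AddSubmonoid.closure_induction with
  | mem x hx =>
    obtain ⟨j, hj, rfl⟩ := hx
    exact ⟨1, by rw [heightForm_simple b ⟨j, hj⟩]; simp, by simp⟩
  | zero => exact ⟨0, by simp, by simp⟩
  | add x y _ _ hx hy =>
    obtain ⟨m, hm, hm'⟩ := hx
    obtain ⟨n, hn, hn'⟩ := hy
    refine ⟨m + n, by rw [map_add, hm, hn]; simp, fun h => ?_⟩
    rw [hm' (by omega), hn' (by omega), add_zero]

variable {b} {θ : ι} (hθ : IsHighestRoot b θ)
include hθ

lemma height_le_highest (k : ι) : b.height k ≤ b.height θ := by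
  obtain ⟨n, hn, -⟩ := heightForm_of_mem_closure b (hθ k)
  rw [map_sub, heightForm_root, heightForm_root] at hn
  have : b.height θ - b.height k = n := by exact_mod_cast hn
  omega

lemma eq_highest {k : ι} (h : b.height k = b.height θ) : k = θ := by
  obtain ⟨n, hn, hn'⟩ := heightForm_of_mem_closure b (hθ k)
  rw [map_sub, heightForm_root, heightForm_root, h, sub_self] at hn
  have : n = 0 := by exact_mod_cast hn.symm
  exact (P.root.injective (sub_eq_zero.1 (hn' this))).symm

lemma highest_pos : 0 < b.height θ := by
  have h1 := height_le_highest hθ (negIdx P θ)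
  have h2 := b.height_ne_zero θ
  rw [height_negIdx] at h1
  omega

lemma height_refl_highest (k : ι) : b.height (perm P (RootPairing.weylGroup.ofIdx P θ) k) =
    b.height k - P.pairingIn ℤ k θ * b.height θ := by
  have h : P.root (perm P (RootPairing.weylGroup.ofIdx P θ) k) =
      P.root k + (-P.pairingIn ℤ k θ) • P.root θ := by
    rw [root_perm_ofIdx, neg_smul, sub_eq_add_neg, ← P.algebraMap_pairingIn ℤ k θ]
    congr 2
    exact Int.cast_smul_eq_zsmul K _ _
  rw [b.height_add_zsmul h, smul_eq_mul]; ring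

lemma pairingIn_highest_lt_two {k : ι} (hk : k ≠ θ) : P.pairingIn ℤ k θ < 2 := by
  by_contra! h
  have h1 := height_le_highest hθ (negIdx P (perm P (RootPairing.weylGroup.ofIdx P θ) k))
  rw [height_negIdx, height_refl_highest hθ] at h1
  have h2 := height_le_highest hθ k
  have h3 := highest_pos hθ
  exact hk (eq_highest hθ (by nlinarith))

lemma neg_two_lt_pairingIn_highest {k : ι} (hk : k ≠ negIdx P θ) : -2 < P.pairingIn ℤ k θ := by
  have h := pairingIn_highest_lt_two hθ (k := negIdx P k) fun h => hk (by rw [← h, negIdx_negIdx])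
  rw [← ip_corootC, ip_negIdx, ip_corootC] at h
  omega

lemma pairingIn_highest_nonneg {k : ι} (hk : b.IsPos k) : 0 ≤ P.pairingIn ℤ k θ := by
  by_contra! h
  have h1 := height_le_highest hθ (perm P (RootPairing.weylGroup.ofIdx P θ) k)
  rw [height_refl_highest hθ] at h1
  have h3 := highest_pos hθ
  have h4 : 0 < b.height k := hk
  nlinarith

/-- The extended affine Weyl group acting on the affine roots, as a reflection system. The simple
affine root of the node `0` is `δ - θ`. -/
def affSys : ReflSys (WExt P) (ι × ℤ) (Option b.support) where
  act := affAct P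
  neg r := (negIdx P r.1, -r.2)
  pos r := 0 < r.2 ∨ r.2 = 0 ∧ b.IsPos r.1
  refl := affRefl P
  simple
    | none => (negIdx P θ, 1)
    | some i => (i, 0)
  pos_neg r := by
    rw [isPos_negIdx]
    rcases lt_trichotomy r.2 0 with h | h | h
    · simp [h.not_gt, h.ne, h]
    · simp [h]
    · simp [h.not_gt, h.ne', h]
  act_neg g r := by
    simp only [affAct_apply, perm_neg, ip_negIdx]
    refine Prod.ext rfl ?_
    ring_nf
  refl_act g r := by
    refine wext_ext P ?_ ?_
    · simp only [affAct_apply, translPart_affRefl, translPart_mul, translPart_inv, finPart_mul,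
        finPart_affRefl, smul_zsmul_coweight, smul_corootC]
      rw [← mul_smul, ← ofIdx_perm, ofIdx_smul_coweight, ip_neg]
      module
    · simp only [affAct_apply, finPart_affRefl, finPart_mul, ofIdx_perm, finPart_inv]
  act_refl_self r := by
    rw [affAct_apply, finPart_affRefl, translPart_affRefl]
    refine Prod.ext rfl ?_
    change _ - ip P (negIdx P r.1) _ = _
    rw [ip_zsmul, ip_negIdx, ip_corootC, P.pairingIn_same]
    ring
  refl_mul_self r := by
    refine wext_ext P ?_ ?_
    · simp only [translPart_affRefl, translPart_mul, finPart_affRefl, smul_zsmul_coweight, smul_corootC]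
      change _ + _ • corootC P (negIdx P r.1) = _
      rw [corootC_negIdx]; simp
    · simp only [finPart_affRefl, finPart_mul, ofIdx_mul_self, finPart_one]
  simple_pos k := by
    rcases k with _ | k
    · exact Or.inl one_pos
    · exact Or.inr ⟨rfl, b.isPos_of_mem_support k.2⟩
  simple_perm k r hr hne := by
    rcases k with _ | k
    · have h1 : affAct P (affRefl P (negIdx P θ, 1)) r =
          (perm P (RootPairing.weylGroup.ofIdx P θ) r.1, r.2 + P.pairingIn ℤ r.1 θ) := by
        rw [affAct_apply, finPart_affRefl, translPart_affRefl, ofIdx_negIdx]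
        refine Prod.ext rfl ?_
        have h2 := ip_perm P (RootPairing.weylGroup.ofIdx P θ) r.1 (corootC P θ)
        rw [smul_corootC] at h2
        change ip P _ (corootC P (negIdx P θ)) = _ at h2
        simp only [ip_zsmul]
        rw [h2, ip_corootC]; ring
      change 0 < (affAct P (affRefl P (negIdx P θ, 1)) r).2 ∨
        (affAct P (affRefl P (negIdx P θ, 1)) r).2 = 0 ∧
        0 < b.height (affAct P (affRefl P (negIdx P θ, 1)) r).1
      rw [h1, height_refl_highest hθ]
      obtain ⟨k, n⟩ := r
      change 0 < n ∨ n = 0 ∧ 0 < b.height k at hr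
      change 0 < n + P.pairingIn ℤ k θ ∨ n + P.pairingIn ℤ k θ = 0 ∧
        0 < b.height k - P.pairingIn ℤ k θ * b.height θ
      have hp := highest_pos hθ
      by_cases hk : k = θ
      · left; subst hk; rw [P.pairingIn_same]; rcases hr with hr | hr <;> omega
      by_cases hk' : k = negIdx P θ
      · subst hk'
        have hn : n ≠ 1 := fun hn => hne (by rw [hn])
        rw [← ip_corootC, ip_negIdx, ip_corootC, P.pairingIn_same, height_negIdx]
        rw [height_negIdx] at hr
        rcases hr with hr | hr
        · rcases (show n = 2 ∨ 2 < n by omega) with h | h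
          · right; subst h; exact ⟨by norm_num, by linarith⟩
          · left; linarith
        · omega
      have h2 := pairingIn_highest_lt_two hθ hk
      have h3 := neg_two_lt_pairingIn_highest hθ hk'
      rcases hr with hr | ⟨rfl, hr⟩
      · rcases (show P.pairingIn ℤ k θ = -1 ∨ 0 ≤ P.pairingIn ℤ k θ by omega) with h | h
        · rcases (show n = 1 ∨ 1 < n by omega) with h' | h'
          · right
            rw [h, h']
            refine ⟨by norm_num, ?_⟩
            have h4 := height_le_highest hθ (negIdx P k)
            rw [height_negIdx] at h4
            have h5 : b.height k ≠ -b.height θ := fun h5 => hk' (by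
              rw [← negIdx_negIdx P k]
              congr 1
              exact eq_highest hθ (by rw [height_negIdx, h5, neg_neg]))
            omega
          · left; omega
        · left; omega
      · have h4 := pairingIn_highest_nonneg hθ (k := k) hr
        rcases (show P.pairingIn ℤ k θ = 0 ∨ 0 < P.pairingIn ℤ k θ by omega) with h | h
        · right; rw [h]; exact ⟨rfl, by linarith⟩
        · left; omega
    · have h1 : affAct P (affRefl P (k, 0)) r =
          (perm P (RootPairing.weylGroup.ofIdx P k) r.1, r.2) := by
        rw [affAct_apply, finPart_affRefl, translPart_affRefl]
        simp
      change 0 < (affAct P (affRefl P (k, 0)) r).2 ∨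
        (affAct P (affRefl P (k, 0)) r).2 = 0 ∧ b.IsPos (affAct P (affRefl P (k, 0)) r).1
      rw [h1]
      rcases hr with hr | hr
      · exact Or.inl hr
      · exact Or.inr ⟨hr.1, (finSys b).simple_perm k r.1 hr.2
          fun h => hne (Prod.ext h hr.1)⟩

end HighestRoot

/-! ### Weights in the field of fractions -/

section Weights

variable {ι K M N : Type*} [Field K] [AddCommGroup M] [Module K M] [AddCommGroup N] [Module K N]
  (P : RootPairing ι K M N) [Finite ι] [CharZero K] [P.IsRootSystem]

/-- A weight as an element of `Frac(S)`. -/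
def wtF : weightLattice P →+ F P :=
  ((algebraMap (S P) (F P)).toAddMonoidHom).comp
    (SymmetricAlgebra.ι ℤ (weightLattice P)).toAddMonoidHom

lemma wtF_apply (x : weightLattice P) :
    wtF P x = algebraMap (S P) (F P) (SymmetricAlgebra.ι ℤ (weightLattice P) x) := rfl

lemma smul_algebraMap (w : P.weylGroup) (s : S P) :
    w • algebraMap (S P) (F P) s = algebraMap (S P) (F P) (w • s) :=
  IsFractionRing.ringEquivOfRingEquiv_algebraMap _ _

lemma smul_wtF (w : P.weylGroup) (x : weightLattice P) : w • wtF P x = wtF P (w • x) := by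
  rw [wtF_apply, smul_algebraMap, wtF_apply]
  congr 1
  exact SymmetricAlgebra.lift_ι_apply _ x

lemma ext_smul (x : WExt P) (c : F P) : x • c = finPart P x • c := rfl

/-- The coroot of a root as a linear form on the weight lattice. -/
def wpHom (k : ι) : weightLattice P →ₗ[ℤ] ℤ where
  toFun := wp P k
  map_add' x y := by
    rw [wp_eq_iff, AddSubgroup.coe_add, map_add, LinearMap.add_apply, wp_spec, wp_spec,
      Int.cast_add]
  map_smul' n x := by
    rw [wp_eq_iff, AddSubgroup.coe_zsmul, map_zsmul, LinearMap.smul_apply, wp_spec]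
    simp

lemma wtF_injective : Function.Injective (wtF P) := by
  rw [injective_iff_map_eq_zero]
  intro x hx
  rw [wtF_apply] at hx
  have hx' : SymmetricAlgebra.ι ℤ (weightLattice P) x = 0 :=
    IsFractionRing.injective (S P) (F P) (by rw [hx, map_zero])
  refine weight_ext P fun k => ?_
  change wpHom P k x = wpHom P k 0
  rw [← SymmetricAlgebra.lift_ι_apply (wpHom P k) x, hx', map_zero, map_zero]

/-- The Weyl group acts faithfully on weights, and hence on `Frac(S)`. -/
lemma eq_one_of_smul_wtF {w : P.weylGroup} [P.IsCrystallographic]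
    (h : ∀ x, w • wtF P x = wtF P x) : w = 1 := by
  apply perm_injective P
  ext k
  apply P.root.injective
  have := wtF_injective P ((smul_wtF P w (rootW P k)).symm.trans (h _))
  rw [smul_rootW] at this
  rw [map_one]
  exact congrArg Subtype.val this

variable [P.IsCrystallographic]

lemma rootF_eq (k : ι) : rootF P k = wtF P (rootW P k) := rfl

lemma rootF_ne_zero (k : ι) : rootF P k ≠ 0 := by
  rw [rootF_eq, Ne, map_eq_zero_iff _ (wtF_injective P)]
  intro h
  exact P.ne_zero k (congrArg Subtype.val h)

lemma smul_rootF (w : P.weylGroup) (k : ι) : w • rootF P k = rootF P (perm P w k) := by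
  rw [rootF_eq, smul_wtF, smul_rootW]; rfl

lemma rootF_negIdx (k : ι) : rootF P (negIdx P k) = -rootF P k := by
  rw [rootF_eq, rootW_negIdx, map_neg]; rfl

lemma wtF_sub_smul (k : ι) (x : weightLattice P) :
    wtF P x - RootPairing.weylGroup.ofIdx P k • wtF P x = wp P k x * rootF P k := by
  rw [smul_wtF, ofIdx_smul_weight, map_sub, sub_sub_cancel, map_zsmul, zsmul_eq_mul]; rfl

end Weights

/-! ### The affine nil-Hecke ring -/

section AffineNilHecke

variable {ι K M N : Type*} [Field K] [AddCommGroup M] [Module K M] [AddCommGroup N] [Module K N]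
  {P : RootPairing ι K M N} [Finite ι] [CharZero K] [P.IsRootSystem] [P.IsCrystallographic]
  [P.IsReduced] {b : P.Base} {θ : ι} (hθ : IsHighestRoot b θ)

lemma affSys_s : (affSys hθ).s = affineRefl b θ := by
  funext k
  rcases k with _ | k
  · change transl P (-1 • corootC P (negIdx P θ)) *
      fin P (RootPairing.weylGroup.ofIdx P (negIdx P θ)) = transl P (corootC P θ) * _
    rw [corootC_negIdx, ofIdx_negIdx]
    simp
  · change transl P (-0 • corootC P k) * fin P (simpleRefl b k) = fin P (simpleRefl b k)
    refine wext_ext P ?_ ?_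
    · simp [translPart_mul]
    · simp [finPart_mul]

lemma affSys_wordProd (l : List (Option b.support)) :
    (affSys hθ).wordProd l = (l.map (affineRefl b θ)).prod := by
  rw [ReflSys.wordProd, affSys_s]

lemma affSys_len (x : WExt P) : (affSys hθ).len x = affineLength b θ x := by
  rw [ReflSys.len, affSys_s]; rfl

lemma affSys_pos {r : ι × ℤ} : (affSys hθ).pos r ↔ 0 < r.2 ∨ r.2 = 0 ∧ b.IsPos r.1 := Iff.rfl

lemma affSys_act (x : WExt P) (r : ι × ℤ) : (affSys hθ).act x r =
    (perm P (finPart P x) r.1, r.2 - ip P (perm P (finPart P x) r.1) (translPart P x)) := rfl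

/-- The data defining the affine nil-Hecke ring, for the level zero action on `Frac(S)`. -/
def affDatum : NilHeckeDatum (affSys hθ) (F P) (weightLattice P) where
  wt := wtF P
  actL x y := finPart P x • y
  pair r x := wp P r.1 x
  c
    | none => -rootF P θ
    | some i => rootF P i
  wt_actL g x := (smul_wtF P _ _).symm
  pair_act g r x := wp_perm P _ _ _
  c_ne_zero k := by
    rcases k with _ | k
    · exact neg_ne_zero.2 (rootF_ne_zero P θ)
    · exact rootF_ne_zero P k
  s_smul_c k := by
    rw [affSys_s]
    rcases k with _ | k
    · change RootPairing.weylGroup.ofIdx P θ • (-rootF P θ) = - -rootF P θ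
      rw [smul_neg, smul_rootF]
      change -rootF P (negIdx P θ) = _
      rw [rootF_negIdx]
    · change RootPairing.weylGroup.ofIdx P k • rootF P k = -rootF P k
      rw [smul_rootF]
      exact rootF_negIdx P k
  wt_sub k x := by
    rw [affSys_s]
    rcases k with _ | k
    · change wtF P x - RootPairing.weylGroup.ofIdx P θ • wtF P x =
        (wp P (negIdx P θ) x : F P) * -rootF P θ
      rw [wtF_sub_smul, wp_negIdx]
      push_cast; ring
    · exact wtF_sub_smul P k x
  eq_one_of_fixed g n h hn hg := by
    have hf : finPart P g = 1 := eq_one_of_smul_wtF P h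
    have hg' : g = transl P (translPart P g) := wext_ext P rfl hf
    have key : ∀ m : ℕ, g ^ m = transl P (m • translPart P g) := by
      intro m
      induction m with
      | zero => rw [pow_zero, zero_smul]; rfl
      | succ m ih =>
        rw [pow_succ, ih, succ_nsmul, ← transl_mul_transl]
        congr 1
    rw [key] at hg
    have h0 : n • translPart P g = 0 := congrArg (translPart P) hg
    have h1 : translPart P g = 0 := coweight_ext P fun k => by
      have h2 := congrArg (ip P k) h0
      rw [← natCast_zsmul, ip_zsmul, ip_zero] at h2
      rw [ip_zero]
      rcases mul_eq_zero.1 h2 with h3 | h3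
      · omega
      · exact h3
    exact wext_ext P h1 hf

lemma affDatum_gen : (affDatum hθ).gen = nilHeckeGen b θ := by
  funext k
  rw [NilHeckeDatum.gen, affSys_s]
  rcases k with _ | k
  · change (-rootF P θ)⁻¹ • (1 - delta P _) = _
    rw [inv_neg]; rfl
  · rfl

lemma nilHecke_eq (x : WExt P) : nilHecke b θ x = (affDatum hθ).elt x := by
  rw [nilHecke, NilHeckeDatum.elt, NilHeckeDatum.word, affDatum_gen, reducedWord]
  simp only [affSys_wordProd, affSys_len]

/-! ### Words in the finite Weyl group -/

lemma affSys_wordProd_some (l : List b.support) :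
    (affSys hθ).wordProd (l.map some) = fin P ((finSys b).wordProd l) := by
  rw [affSys_wordProd, List.map_map, ReflSys.wordProd, map_list_prod, List.map_map]
  rfl

lemma exists_affWord_fin (w : P.weylGroup) :
    ∃ l : List b.support, (finSys b).Reduced l ∧ (finSys b).wordProd l = w ∧
      (affSys hθ).wordProd (l.map some) = fin P w := by
  obtain ⟨l, hl⟩ := exists_finWord b w
  obtain ⟨m, hm, hm'⟩ := (finSys b).exists_word l
  refine ⟨m, ?_, by rw [hm, hl], by rw [affSys_wordProd_some, hm, hl]⟩
  rw [ReflSys.reduced_iff, hm, hm']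

/-- The lengths of an element of `W` in `W` and in the affine Weyl group agree. -/
lemma reduced_map_some {l : List b.support} (hl : (finSys b).Reduced l) :
    (affSys hθ).Reduced (l.map some) := by
  rw [ReflSys.reduced_iff, (affSys hθ).len_eq_ncard rfl, List.length_map,
    ← (ReflSys.reduced_iff _ _).1 hl, (finSys b).len_eq_ncard rfl, affSys_wordProd_some]
  have : {r : ι × ℤ | (affSys hθ).pos r ∧
      ¬ (affSys hθ).pos ((affSys hθ).act (fin P ((finSys b).wordProd l)) r)} =
      (fun k => (k, (0 : ℤ))) '' {k | (finSys b).pos k ∧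
        ¬ (finSys b).pos ((finSys b).act ((finSys b).wordProd l) k)} := by
    ext ⟨k, n⟩
    simp only [Set.mem_ofPred_eq, affSys_pos, affSys_act, finPart_fin, translPart_fin, ip_zero,
      sub_zero, Set.mem_image, Prod.mk.injEq]
    constructor
    · rintro ⟨h1 | ⟨rfl, h1⟩, h2⟩
      · exact absurd (Or.inl h1) h2
      · exact ⟨k, ⟨h1, fun h => h2 (Or.inr ⟨rfl, h⟩)⟩, rfl, rfl⟩
    · rintro ⟨k', ⟨h1, h2⟩, rfl, rfl⟩
      exact ⟨Or.inr ⟨rfl, h1⟩, fun h => h2 (h.resolve_left (lt_irrefl _)).2⟩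
  rw [this, Set.ncard_image_of_injective _ fun _ _ h => (Prod.mk.inj h).1]

lemma nilHecke_fin {l : List b.support} (hl : (finSys b).Reduced l) :
    nilHecke b θ (fin P ((finSys b).wordProd l)) = (affDatum hθ).word (l.map some) := by
  rw [nilHecke_eq hθ, ← affSys_wordProd_some hθ,
    (affDatum hθ).elt_eq (reduced_map_some hθ hl)]

/-! ### The Bruhat order and localization -/

lemma BruhatLE.trans {u v w : P.weylGroup} (h1 : BruhatLE b u v) (h2 : BruhatLE b v w) :
    BruhatLE b u w := Relation.ReflTransGen.trans h1 h2

lemma BruhatLE.length_le {u v : P.weylGroup} (h : BruhatLE b u v) : length b u ≤ length b v := by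
  induction h with
  | refl => exact le_rfl
  | tail _ h ih => obtain ⟨-, -, h⟩ := h; omega

/-- The lifting property of the Bruhat order. -/
lemma bruhatLE_mul_simple {v w : P.weylGroup} (h : BruhatLE b v w) (k : b.support) :
    BruhatLE b (v * simpleRefl b k) w ∨
      BruhatLE b (v * simpleRefl b k) (w * simpleRefl b k) := by
  induction h using Relation.ReflTransGen.head_induction_on with
  | refl => exact Or.inr Relation.ReflTransGen.refl
  | @head v z hvz hzw ih =>
    obtain ⟨β, rfl, hlt⟩ := hvz
    -- the reflecting root may be taken to be positive
    obtain ⟨β, hβ, hlt, hzw, ih⟩ : ∃ β', b.IsPos β' ∧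
        length b v < length b (v * RootPairing.weylGroup.ofIdx P β') ∧
        BruhatLE b (v * RootPairing.weylGroup.ofIdx P β') w ∧
        (BruhatLE b (v * RootPairing.weylGroup.ofIdx P β' * simpleRefl b k) w ∨
          BruhatLE b (v * RootPairing.weylGroup.ofIdx P β' * simpleRefl b k)
            (w * simpleRefl b k)) := by
      by_cases hβ : b.IsPos β
      · exact ⟨β, hβ, hlt, hzw, ih⟩
      · exact ⟨negIdx P β, (isPos_negIdx b β).2 hβ, by rwa [ofIdx_negIdx],
          by rw [ofIdx_negIdx]; exact hzw, by rwa [ofIdx_negIdx]⟩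
    have hvβ : b.IsPos (perm P v β) := by
      by_contra hneg
      obtain ⟨l, hl⟩ := exists_finWord b v
      have := (finSys b).len_mul_refl_of_neg hl hβ hneg
      exact absurd hlt (not_lt.2 this.le)
    by_cases hk : β = k
    · subst hk
      exact Or.inl hzw
    · have h1 : b.IsPos (perm P (simpleRefl b k) β) := (finSys b).simple_perm k β hβ hk
      have h2 : v * RootPairing.weylGroup.ofIdx P β * simpleRefl b k =
          v * simpleRefl b k * RootPairing.weylGroup.ofIdx P (perm P (simpleRefl b k) β) := by
        rw [ofIdx_perm, simpleRefl]
        have := ofIdx_mul_self P k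
        rw [inv_eq_of_mul_eq_one_left this, mul_assoc v, mul_assoc v, ← mul_assoc _ (_ * _),
          ← mul_assoc _ (RootPairing.weylGroup.ofIdx P (k : ι)), this, one_mul]
      obtain ⟨l, hl⟩ := exists_finWord b (v * simpleRefl b k *
        RootPairing.weylGroup.ofIdx P (perm P (simpleRefl b k) β))
      have h3 := (finSys b).len_mul_refl_of_pos (x := v * simpleRefl b k) h1 hl (by
        change b.IsPos (perm P _ _)
        rw [← perm_mul, mul_assoc, simpleRefl, ofIdx_mul_self, mul_one]
        exact hvβ)
      have h4 : BruhatLE b (v * simpleRefl b k)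
          (v * RootPairing.weylGroup.ofIdx P β * simpleRefl b k) := by
        rw [h2]
        exact Relation.ReflTransGen.single ⟨_, rfl, h3⟩
      exact ih.imp h4.trans h4.trans

open SkewMonoidAlgebra in
/-- Triangularity of `A_u = ∑ c_{u,v} δ_v` along a reduced word of `u`: the support lies in the
Bruhat interval below `u`, and the coefficient of `δ_u` does not vanish. -/
lemma word_coeff (l : List b.support) (hl : (finSys b).Reduced l) :
    (∀ x, ((affDatum hθ).word (l.map some)).coeff x ≠ 0 →
      ∃ v, x = fin P v ∧ BruhatLE b v ((finSys b).wordProd l)) ∧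
    ((affDatum hθ).word (l.map some)).coeff (fin P ((finSys b).wordProd l)) ≠ 0 := by
  classical
  induction l using List.reverseRecOn with
  | nil =>
    simp only [List.map_nil, NilHeckeDatum.word_nil, ReflSys.wordProd_nil, map_one, coeff_one]
    refine ⟨fun x hx => ⟨1, ?_, Relation.ReflTransGen.refl⟩, by simp⟩
    rw [map_one]
    by_contra h
    exact hx (Finsupp.single_eq_of_ne h)
  | append_singleton l k ih =>
    obtain ⟨ih1, ih2⟩ := ih hl.of_append_left
    set u := (finSys b).wordProd l with hu
    have hprod : (finSys b).wordProd (l ++ [k]) = u * simpleRefl b k := by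
      rw [ReflSys.wordProd_append, ReflSys.wordProd_cons, ReflSys.wordProd_nil, mul_one]; rfl
    have hlt : length b u < length b (u * simpleRefl b k) := by
      rw [← hprod, length_eq_len, length_eq_len, (ReflSys.reduced_iff _ _).1 hl, hu,
        (ReflSys.reduced_iff _ _).1 hl.of_append_left]
      simp
    have hle : BruhatLE b u (u * simpleRefl b k) := Relation.ReflTransGen.single ⟨k, rfl, hlt⟩
    set a := (affDatum hθ).word (l.map some) with ha
    have hs : (affSys hθ).s (some k) = fin P (simpleRefl b k) := by rw [affSys_s]; rfl
    have hcoeff : ∀ x, ((affDatum hθ).word ((l ++ [k]).map some)).coeff x =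
        (a.coeff x + a.coeff (x * fin P (simpleRefl b k))) * x • (rootF P k)⁻¹ := by
      intro x
      have hc : fin P (simpleRefl b k) • (rootF P k)⁻¹ = -(rootF P k)⁻¹ := by
        have := (affDatum hθ).s_smul_c (some k)
        rw [hs] at this
        change fin P (simpleRefl b k) • rootF P k = -rootF P k at this
        rw [smul_inv'', this, inv_neg]
      have hss : fin P (simpleRefl b k) * fin P (simpleRefl b k) = 1 := by
        rw [← hs]; exact (affSys hθ).s_mul_self _
      rw [List.map_append, NilHeckeDatum.word_append, List.map_cons, List.map_nil,
        NilHeckeDatum.word_cons, NilHeckeDatum.word_nil, mul_one, NilHeckeDatum.gen_eq, hs]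
      change (a * (single 1 (rootF P k)⁻¹ - single _ (rootF P k)⁻¹)).coeff x = _
      rw [mul_sub, coeff_sub, Finsupp.sub_apply, coeff_mul_single_one, coeff_mul_single,
        inv_eq_of_mul_eq_one_left hss, mul_smul, hc, smul_neg]
      ring
    rw [hprod]
    refine ⟨fun x hx => ?_, ?_⟩
    · rw [hcoeff] at hx
      by_cases h0 : a.coeff x = 0
      · rw [h0, zero_add] at hx
        obtain ⟨v, hv, hvu⟩ := ih1 _ (left_ne_zero_of_mul hx)
        refine ⟨v * simpleRefl b k, ?_, ?_⟩
        · rw [map_mul, ← hv, mul_assoc, ← hs, (affSys hθ).s_mul_self, mul_one]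
        · exact (bruhatLE_mul_simple hvu k).elim (fun h => h.trans hle) id
      · obtain ⟨v, hv, hvu⟩ := ih1 _ h0
        exact ⟨v, hv, hvu.trans hle⟩
    · rw [hcoeff]
      have h0 : a.coeff (fin P (u * simpleRefl b k)) = 0 := by
        by_contra h0
        obtain ⟨v, hv, hvu⟩ := ih1 _ h0
        have hv' : u * simpleRefl b k = v := SemidirectProduct.inr_injective hv
        exact absurd hvu.length_le (by rw [← hv']; omega)
      rw [h0, zero_add, ← map_mul, mul_assoc, simpleRefl, ofIdx_mul_self, mul_one, ext_smul]
      refine mul_ne_zero ih2 ?_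
      rw [Ne, smul_eq_zero_iff_eq]
      exact inv_ne_zero (rootF_ne_zero P k)

end AffineNilHecke

open scoped Classical

/-! ### Inverting the localization matrix -/

section Localization

lemma fin_injective {ι K M N : Type*} [Field K] [AddCommGroup M] [Module K M] [AddCommGroup N]
    [Module K N] (P : RootPairing ι K M N) : Function.Injective (fin P) :=
  SemidirectProduct.inr_injective

variable {ι K M N : Type*} [Field K] [AddCommGroup M] [Module K M] [AddCommGroup N] [Module K N]
  {P : RootPairing ι K M N} [Finite ι] [CharZero K] [P.IsRootSystem] [P.IsCrystallographic]
  [P.IsReduced] {b : P.Base} {θ : ι} (hθ : IsHighestRoot b θ)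

lemma BruhatLE.eq_or_length_lt {u v : P.weylGroup} (h : BruhatLE b u v) :
    u = v ∨ length b u < length b v := by
  rcases Relation.ReflTransGen.cases_tail h with h | ⟨w, hw, -, -, hlt⟩
  · exact Or.inl h.symm
  · exact Or.inr ((BruhatLE.length_le hw).trans_lt hlt)

variable (b θ) in
/-- The coefficient of `δ_v` in `A_u`. -/
def nhCoeff (u v : P.weylGroup) : F P := (nilHecke b θ (fin P u)).coeff (fin P v)

include hθ

lemma nhCoeff_support {u v : P.weylGroup} (h : nhCoeff b θ u v ≠ 0) : BruhatLE b v u := by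
  obtain ⟨l, hl, rfl, -⟩ := exists_affWord_fin hθ u
  rw [nhCoeff, nilHecke_fin hθ hl] at h
  obtain ⟨w, hw, hle⟩ := (word_coeff hθ l hl).1 _ h
  rwa [fin_injective P hw]

lemma nhCoeff_diag (u : P.weylGroup) : nhCoeff b θ u u ≠ 0 := by
  obtain ⟨l, hl, rfl, -⟩ := exists_affWord_fin hθ u
  rw [nhCoeff, nilHecke_fin hθ hl]
  exact (word_coeff hθ l hl).2

lemma nilHecke_fin_eq_sum [Fintype P.weylGroup] (u : P.weylGroup) :
    nilHecke b θ (fin P u) = ∑ v, nhCoeff b θ u v • delta P (fin P v) := by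
  have hcoeff : ∀ (v : P.weylGroup) (c : F P) (x : WExt P),
      (c • delta P (fin P v)).coeff x = if fin P v = x then c else 0 := by
    intro v c x
    rw [delta, SkewMonoidAlgebra.smul_of, SkewMonoidAlgebra.coeff_single_apply]
  ext x
  have hsum : (∑ v, nhCoeff b θ u v • delta P (fin P v)).coeff x =
      ∑ v, if fin P v = x then nhCoeff b θ u v else 0 := by
    have := map_sum ((Finsupp.applyAddHom x).comp
      (SkewMonoidAlgebra.coeffAddEquiv (k := F P) (G := WExt P)).toAddMonoidHom)
      (fun v => nhCoeff b θ u v • delta P (fin P v)) Finset.univ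
    refine this.trans (Finset.sum_congr rfl fun v _ => hcoeff v _ x)
  rw [hsum]
  by_cases hx : ∃ v, fin P v = x
  · obtain ⟨v, rfl⟩ := hx
    rw [Finset.sum_eq_single v (fun w _ hw => if_neg fun h =>
      hw (fin_injective P h)) (by simp), if_pos rfl]
    rfl
  · rw [Finset.sum_eq_zero fun v _ => if_neg fun h => hx ⟨v, h⟩]
    by_contra h0
    obtain ⟨l, hl, rfl, -⟩ := exists_affWord_fin hθ u
    rw [nilHecke_fin hθ hl] at h0
    obtain ⟨v, hv, -⟩ := (word_coeff hθ l hl).1 _ h0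
    exact hx ⟨v, hv.symm⟩

/-- Inverting the triangular matrix `(c_{u,v})`: each `δ_u` is a combination of the `A_v` with
`v ≤ u` in the Bruhat order. -/
lemma exists_delta_eq_sum [Fintype P.weylGroup] (u : P.weylGroup) : ∃ f : P.weylGroup → F P,
    (∀ v, f v ≠ 0 → BruhatLE b v u) ∧
      delta P (fin P u) = ∑ v, f v • nilHecke b θ (fin P v) := by
  induction hn : length b u using Nat.strong_induction_on generalizing u with
  | _ n IH =>
  have IH' : ∀ w, ∃ g : P.weylGroup → F P, (w ≠ u → nhCoeff b θ u w ≠ 0 →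
      (∀ v, g v ≠ 0 → BruhatLE b v u) ∧
        delta P (fin P w) = ∑ v, g v • nilHecke b θ (fin P v)) := by
    intro w
    by_cases h : w ≠ u ∧ nhCoeff b θ u w ≠ 0
    · have hle := nhCoeff_support hθ h.2
      obtain ⟨g, hg1, hg2⟩ := IH (length b w)
        (by rw [← hn]; exact hle.eq_or_length_lt.resolve_left h.1) w rfl
      exact ⟨g, fun _ _ => ⟨fun v hv => (hg1 v hv).trans hle, hg2⟩⟩
    · exact ⟨0, fun h1 h2 => absurd ⟨h1, h2⟩ h⟩
  choose g hg using IH'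
  refine ⟨fun v => (nhCoeff b θ u u)⁻¹ * ((if v = u then 1 else 0) -
    ∑ w ∈ Finset.univ.erase u, nhCoeff b θ u w * g w v), fun v hv => ?_, ?_⟩
  · by_contra hle
    refine hv ?_
    beta_reduce
    have hvu : v ≠ u := fun h => hle (h ▸ Relation.ReflTransGen.refl)
    rw [if_neg hvu, Finset.sum_eq_zero, sub_zero, mul_zero]
    intro w hw
    by_contra h0
    exact hle ((hg w (Finset.ne_of_mem_erase hw) (left_ne_zero_of_mul h0)).1 v
      (right_ne_zero_of_mul h0))
  · have h1 := nilHecke_fin_eq_sum hθ u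
    rw [← Finset.add_sum_erase _ _ (Finset.mem_univ u)] at h1
    have h2 : ∑ w ∈ Finset.univ.erase u, nhCoeff b θ u w • delta P (fin P w) =
        ∑ v, (∑ w ∈ Finset.univ.erase u, nhCoeff b θ u w * g w v) • nilHecke b θ (fin P v) := by
      simp_rw [Finset.sum_smul]
      rw [Finset.sum_comm]
      refine Finset.sum_congr rfl fun w hw => ?_
      by_cases h0 : nhCoeff b θ u w = 0
      · simp [h0]
      · conv_lhs => rw [(hg w (Finset.ne_of_mem_erase hw) h0).2]
        rw [Finset.smul_sum]
        simp_rw [mul_smul]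
    have h3 : ∑ v, ((nhCoeff b θ u u)⁻¹ * ((if v = u then 1 else 0) -
        ∑ w ∈ Finset.univ.erase u, nhCoeff b θ u w * g w v)) • nilHecke b θ (fin P v) =
        (nhCoeff b θ u u)⁻¹ • (nilHecke b θ (fin P u) -
          ∑ w ∈ Finset.univ.erase u, nhCoeff b θ u w • delta P (fin P w)) := by
      rw [h2]
      simp_rw [mul_smul, sub_smul]
      rw [← Finset.smul_sum, Finset.sum_sub_distrib]
      congr 2
      rw [Finset.sum_eq_single u (fun v _ hv => by
        rw [if_neg hv]; exact zero_smul (F P) (nilHecke b θ (fin P v))) (by simp), if_pos rfl, one_smul]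
    rw [h3, h1, add_sub_cancel_right, smul_smul, inv_mul_cancel₀ (nhCoeff_diag hθ u), one_smul]

/-- The localization formula `δ_u = ∑_{v ≤ u} ξ^v(u) A_v`. -/
lemma sum_schubertValue (u : P.weylGroup) :
    ∑ v ∈ bruhatIic b u, schubertValue b θ v u • nilHecke b θ (fin P v) = delta P (fin P u) := by
  let := Fintype.ofFinite P.weylGroup
  choose f hf1 hf2 using exists_delta_eq_sum hθ
  have hC : ∀ v w, matC b θ v w = nhCoeff b θ v w := fun _ _ => rfl
  have hinv : (matC b θ).transpose⁻¹ = Matrix.of fun v u => f u v := by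
    refine Matrix.inv_eq_right_inv ?_
    ext w u
    rw [Matrix.mul_apply]
    have h := congrArg (fun a => a.coeff (fin P w)) (hf2 u)
    have hsum : (∑ v, f u v • nilHecke b θ (fin P v)).coeff (fin P w) =
        ∑ v, f u v * nhCoeff b θ v w := by
      have := map_sum ((Finsupp.applyAddHom (fin P w)).comp
        (SkewMonoidAlgebra.coeffAddEquiv (k := F P) (G := WExt P)).toAddMonoidHom)
        (fun v => f u v • nilHecke b θ (fin P v)) Finset.univ
      exact this
    rw [hsum] at h
    simp only [Matrix.transpose_apply, Matrix.of_apply]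
    simp_rw [hC, mul_comm (nhCoeff b θ _ w)]
    rw [← h]
    change (SkewMonoidAlgebra.single (fin P u) (1 : F P)).coeff (fin P w) = _
    rw [SkewMonoidAlgebra.coeff_single_apply, Matrix.one_apply]
    by_cases hwu : w = u
    · simp [hwu]
    · rw [if_neg hwu, if_neg fun h => hwu (fin_injective P h).symm]
  have hval : ∀ v, schubertValue b θ v u = f u v := by
    intro v
    change (matC b θ).transpose⁻¹ v u = _
    rw [hinv]; rfl
  rw [hf2 u]
  simp_rw [hval]
  refine Finset.sum_subset (Finset.subset_univ _) fun v _ hv => ?_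
  have : f u v = 0 := by
    by_contra h
    exact hv (by simpa [bruhatIic] using hf1 u v h)
  rw [this]
  exact zero_smul (F P) (nilHecke b θ (fin P v))

end Localization

/-! ### Minimal coset representatives for a cominuscule node -/

section Cominuscule

variable {ι K M N : Type*} [Field K] [AddCommGroup M] [Module K M] [AddCommGroup N] [Module K N]
  {P : RootPairing ι K M N} [Finite ι] [CharZero K] [P.IsRootSystem] [P.IsCrystallographic]
  [P.IsReduced] {b : P.Base} {i : b.support}

lemma ip_add_root {k l m : ι} (h : P.root k = P.root l + P.root m) (y : coweightLattice P) :
    ip P k y = ip P l y + ip P m y := by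
  rw [ip_eq_iff, h, map_add, LinearMap.add_apply, ip_spec, ip_spec, Int.cast_add]

lemma root_perm_add {k l m : ι} (h : P.root k = P.root l + P.root m) (w : P.weylGroup) :
    P.root (perm P w k) = P.root (perm P w l) + P.root (perm P w m) := by
  rw [root_perm, root_perm, root_perm, h, smul_add]

lemma ip_simple (j : b.support) : ip P j (fundCoweight b i) = if j = i then 1 else 0 := by
  rw [ip_eq_iff]
  change P.toLinearMap (P.root j) (fundCoweightVec b i) = _
  rw [pairing_fundCoweightVec, ← b.toWeightBasis_apply j, Module.Basis.coord_apply,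
    Module.Basis.repr_self]
  by_cases h : j = i
  · subst h; simp
  · rw [Finsupp.single_eq_of_ne (Ne.symm h), if_neg h]; simp

variable (b i) in
/-- `w` is the shortest element of its coset modulo the stabilizer of `ϖ_i^∨`: it keeps positive the
positive roots orthogonal to `ϖ_i^∨`. -/
def IsMinRep (w : P.weylGroup) : Prop :=
  ∀ k, b.IsPos k → ip P k (fundCoweight b i) = 0 → b.IsPos (perm P w k)

variable (hi : IsCominuscule b i)
include hi

lemma ip_of_isPos {k : ι} (hk : b.IsPos k) :
    ip P k (fundCoweight b i) = 0 ∨ ip P k (fundCoweight b i) = 1 := by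
  rcases hi k hk with h | h
  · exact Or.inl ((ip_eq_iff P).2 (by rw [h, Int.cast_zero]))
  · exact Or.inr ((ip_eq_iff P).2 (by rw [h, Int.cast_one]))

lemma ip_of_not_isPos {k : ι} (hk : ¬ b.IsPos k) :
    ip P k (fundCoweight b i) = 0 ∨ ip P k (fundCoweight b i) = -1 := by
  have := ip_of_isPos hi ((isPos_negIdx b k).2 hk)
  rw [ip_negIdx] at this
  omega

lemma isPos_of_ip_eq_one {k : ι} (hk : ip P k (fundCoweight b i) = 1) : b.IsPos k := by
  by_contra h
  have := ip_of_not_isPos hi h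
  omega

lemma not_isPos_of_ip_eq_neg_one {k : ι} (hk : ip P k (fundCoweight b i) = -1) :
    ¬ b.IsPos k := by
  intro h
  have := ip_of_isPos hi h
  omega

/-- It suffices to test the defining condition of `IsMinRep` on simple roots. -/
lemma isMinRep_of_simple {w : P.weylGroup}
    (h : ∀ j : b.support, ip P j (fundCoweight b i) = 0 → b.IsPos (perm P w j)) :
    IsMinRep b i w := by
  intro k hk
  refine (hk.induction_on_add (p := fun k => b.IsPos k ∧
    (ip P k (fundCoweight b i) = 0 → b.IsPos (perm P w k))) ?_ ?_).2
  · exact fun j hj => ⟨b.isPos_of_mem_support hj, h ⟨j, hj⟩⟩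
  · rintro l j k hk ⟨hl, hl'⟩ hj
    refine ⟨hl.add (b.isPos_of_mem_support hj) hk, fun h0 => ?_⟩
    rw [ip_add_root hk] at h0
    have h1 := ip_of_isPos hi hl
    have h2 := ip_of_isPos hi (b.isPos_of_mem_support hj)
    have h3 : ip P j (fundCoweight b i) = 0 := by omega
    exact (hl' (by omega)).add (h ⟨j, hj⟩ h3) (root_perm_add hk w)

lemma exists_shorter {w : P.weylGroup} (h : ¬ IsMinRep b i w) : ∃ w' : P.weylGroup,
    w' • fundCoweight b i = w • fundCoweight b i ∧ length b w' < length b w := by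
  have h' : ∃ j : b.support, ip P j (fundCoweight b i) = 0 ∧ ¬ b.IsPos (perm P w j) := by
    by_contra! hc
    exact h (isMinRep_of_simple hi hc)
  obtain ⟨j, hj, hneg⟩ := h'
  refine ⟨w * RootPairing.weylGroup.ofIdx P j, ?_, ?_⟩
  · rw [mul_smul, ofIdx_smul_coweight, hj, zero_smul, sub_zero]
  · obtain ⟨l, hl⟩ := exists_finWord b w
    exact (finSys b).len_mul_refl_of_neg hl (b.isPos_of_mem_support j.2) hneg

lemma exists_isMinRep (w : P.weylGroup) :
    ∃ w', IsMinRep b i w' ∧ w' • fundCoweight b i = w • fundCoweight b i := by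
  induction hn : length b w using Nat.strong_induction_on generalizing w with
  | _ n IH =>
  by_cases h : IsMinRep b i w
  · exact ⟨w, h, rfl⟩
  · obtain ⟨w', h1, h2⟩ := exists_shorter hi h
    obtain ⟨w'', h3, h4⟩ := IH _ (hn ▸ h2) w' rfl
    exact ⟨w'', h3, h4.trans h1⟩

/-- A coset modulo the stabilizer of `ϖ_i^∨` has only one minimal representative. -/
lemma IsMinRep.eq {w w' : P.weylGroup} (hw : IsMinRep b i w) (hw' : IsMinRep b i w')
    (h : w • fundCoweight b i = w' • fundCoweight b i) : w = w' := by
  have hp : (w⁻¹ * w') • fundCoweight b i = fundCoweight b i := by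
    rw [mul_smul, ← h, inv_smul_smul]
  refine (inv_mul_eq_one.1 (eq_one_of_isPos b fun k => ?_))
  have hk := b.isPos_of_mem_support k.2
  have hip := ip_perm P (w⁻¹ * w') k (fundCoweight b i)
  rw [hp] at hip
  rcases ip_of_isPos hi hk with h0 | h1
  · by_contra hneg
    have h2 := hw _ ((isPos_negIdx b _).2 hneg) (by rw [ip_negIdx, hip, h0, neg_zero])
    rw [perm_neg, isPos_negIdx, perm_mul, perm_perm_inv] at h2
    exact h2 (hw' _ hk h0)
  · exact isPos_of_ip_eq_one hi (hip.trans h1)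

omit hi in
lemma not_isPos_longest {k : ι} (hk : b.IsPos k) : ¬ b.IsPos (perm P (longest b) k) := by
  have hs : ∀ j ∈ b.support, ¬ b.IsPos (perm P (longest b) j) := by
    intro j hj hpos
    obtain ⟨l, hl⟩ := exists_finWord b (longest b)
    have h1 := (finSys b).len_mul_s_of_pos hl (k := ⟨j, hj⟩) hpos
    have h2 : length b (longest b * (finSys b).s ⟨j, hj⟩) ≤ length b (longest b) :=
      (Finite.exists_max (length b)).choose_spec _
    rw [length_eq_len, length_eq_len] at h2
    omega
  refine hk.induction_on_add (p := fun k => ¬ b.IsPos (perm P (longest b) k)) hs ?_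
  intro l j k hk hl hj hpos
  have h1 := b.height_add (root_perm_add hk (longest b))
  have h2 := hs j hj
  simp only [RootPairing.Base.IsPos] at hl h2 hpos
  omega

lemma ip_antidominant {k : ι} (hk : b.IsPos k) :
    ip P k (longest b • fundCoweight b i) = 0 ∨ ip P k (longest b • fundCoweight b i) = -1 := by
  rw [ip_smul]
  refine ip_of_not_isPos hi fun h => ?_
  have := not_isPos_longest h
  rw [perm_perm_inv] at this
  exact this hk

omit hi in
lemma vElt_smul : vElt b i • fundCoweight b i = longest b • fundCoweight b i :=
  Function.argminOn_mem (length b) {w | w • fundCoweight b i = longest b • fundCoweight b i}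
    ⟨longest b, rfl⟩

lemma isMinRep_vElt : IsMinRep b i (vElt b i) := by
  by_contra h
  obtain ⟨w, h1, h2⟩ := exists_shorter hi h
  exact absurd h2 (not_lt.2 (Function.argminOn_le (length b)
    {w | w • fundCoweight b i = longest b • fundCoweight b i} (h1.trans vElt_smul)))

/-- The sign of `w(β)`, for `w` a minimal representative such that `w(ϖ_i^∨)` is antidominant. -/
lemma isPos_perm_iff_of_antidominant {w : P.weylGroup} (hw : IsMinRep b i w)
    (ha : ∀ k, b.IsPos k → ip P k (w • fundCoweight b i) ≤ 0) (k : ι) : b.IsPos (perm P w k) ↔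
    ip P k (fundCoweight b i) = -1 ∨ ip P k (fundCoweight b i) = 0 ∧ b.IsPos k := by
  have h1 : ∀ k, ip P k (fundCoweight b i) = 1 → ¬ b.IsPos (perm P w k) := by
    intro k hk hpos
    have := ha _ hpos
    rw [ip_perm] at this
    omega
  have h0 : ∀ k, ip P k (fundCoweight b i) = -1 → b.IsPos (perm P w k) := by
    intro k hk
    have := h1 (negIdx P k) (by rw [ip_negIdx, hk]; rfl)
    rwa [perm_neg, isPos_negIdx, not_not] at this
  by_cases hk : b.IsPos k
  · rcases ip_of_isPos hi hk with h | h
    · simp [h, hk, hw k hk h]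
    · simp [h, h1 k h]
  · rcases ip_of_not_isPos hi hk with h | h
    · have := hw _ ((isPos_negIdx b k).2 hk) (by rw [ip_negIdx, h, neg_zero])
      rw [perm_neg, isPos_negIdx] at this
      simp [h, hk, this]
    · simp [h, h0 k h]

lemma ip_vElt_nonpos {k : ι} (hk : b.IsPos k) : ip P k (vElt b i • fundCoweight b i) ≤ 0 := by
  have := ip_antidominant hi hk
  rw [vElt_smul]
  omega

lemma isPos_vElt_iff (k : ι) : b.IsPos (perm P (vElt b i) k) ↔
    ip P k (fundCoweight b i) = -1 ∨ ip P k (fundCoweight b i) = 0 ∧ b.IsPos k :=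
  isPos_perm_iff_of_antidominant hi (isMinRep_vElt hi) (fun _ => ip_vElt_nonpos hi) k

lemma IsMinRep.eq_vElt {w : P.weylGroup} (hw : IsMinRep b i w)
    (ha : ∀ k, b.IsPos k → ip P k (w • fundCoweight b i) ≤ 0) : w = vElt b i := by
  refine mul_inv_eq_one.1 (eq_one_of_isPos b fun k => ?_)
  rw [perm_mul, isPos_perm_iff_of_antidominant hi hw ha, ← isPos_vElt_iff hi, perm_perm_inv]
  exact b.isPos_of_mem_support k.2

/-- The lengths of the factors in `v_i = (v_i w⁻¹) w` exceed the length of `v_i` by twice the number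
of positive roots orthogonal to `ϖ_i^∨` that `w` makes negative. -/
lemma length_add_length (w : P.weylGroup) : length b (vElt b i * w⁻¹) + length b w =
    {k | ip P k (fundCoweight b i) = 1}.ncard +
      2 * {k | b.IsPos k ∧ ip P k (fundCoweight b i) = 0 ∧ ¬ b.IsPos (perm P w k)}.ncard := by
  have e1 : length b w = {k | ip P k (fundCoweight b i) = 1 ∧ ¬ b.IsPos (perm P w k)}.ncard +
      {k | b.IsPos k ∧ ip P k (fundCoweight b i) = 0 ∧ ¬ b.IsPos (perm P w k)}.ncard := by
    rw [length_eq_ncard, ← Set.ncard_union_eq]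
    · congr 1
      ext k
      have h1 := fun h => ip_of_isPos hi (k := k) h
      have h2 := fun h => isPos_of_ip_eq_one hi (k := k) h
      simp only [Set.mem_union, Set.mem_ofPred_eq]
      tauto
    · rw [Set.disjoint_left]
      rintro k ⟨h1, -⟩ ⟨-, h2, -⟩
      omega
  have e2 : length b (vElt b i * w⁻¹) =
      {k | ip P k (fundCoweight b i) = 1 ∧ b.IsPos (perm P w k)}.ncard +
      {k | b.IsPos k ∧ ip P k (fundCoweight b i) = 0 ∧ ¬ b.IsPos (perm P w k)}.ncard := by
    have e3 : {k | b.IsPos k ∧ ip P k (fundCoweight b i) = 0 ∧ ¬ b.IsPos (perm P w k)}.ncard =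
        {k | ¬ b.IsPos k ∧ ip P k (fundCoweight b i) = 0 ∧ b.IsPos (perm P w k)}.ncard := by
      rw [← Set.ncard_image_of_injective _ (negIdx_involutive P).injective]
      congr 1
      ext k
      rw [Set.mem_image_iff_of_inverse (negIdx_involutive P).leftInverse
        (negIdx_involutive P).rightInverse]
      simp only [Set.mem_ofPred_eq, isPos_negIdx, ip_negIdx, perm_neg, neg_eq_zero, not_not]
    rw [length_eq_ncard, e3, ← Set.ncard_union_eq,
      ← Set.ncard_image_of_injective _ (perm P w⁻¹).injective]
    · congr 1
      ext k
      rw [Set.mem_image_iff_of_inverse (g := perm P w) (fun k => by simp) (fun k => by simp)]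
      have h1 := fun h => isPos_of_ip_eq_one hi (k := k) h
      have h2 := fun h => ip_of_isPos hi (k := k) h
      have h3 := fun h => ip_of_not_isPos hi (k := k) h
      simp only [Set.mem_union, Set.mem_ofPred_eq, perm_mul, perm_inv_perm, isPos_vElt_iff hi]
      by_cases hk : b.IsPos k
      · rcases h2 hk with h | h <;> simp [h, hk]
      · rcases h3 hk with h | h <;> simp [h, hk]
    · rw [Set.disjoint_left]
      rintro k ⟨h1, -⟩ ⟨-, h2, -⟩
      omega
  have e4 : {k | ip P k (fundCoweight b i) = 1}.ncard =
      {k | ip P k (fundCoweight b i) = 1 ∧ b.IsPos (perm P w k)}.ncard +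
      {k | ip P k (fundCoweight b i) = 1 ∧ ¬ b.IsPos (perm P w k)}.ncard := by
    rw [← Set.ncard_union_eq]
    · congr 1
      ext k
      simp only [Set.mem_union, Set.mem_ofPred_eq]
      tauto
    · rw [Set.disjoint_left]
      rintro k ⟨-, h1⟩ ⟨-, h2⟩
      exact h2 h1
  omega

lemma isMinRep_iff_ncard (w : P.weylGroup) : IsMinRep b i w ↔
    {k | b.IsPos k ∧ ip P k (fundCoweight b i) = 0 ∧ ¬ b.IsPos (perm P w k)}.ncard = 0 := by
  rw [Set.ncard_eq_zero (Set.toFinite _), Set.eq_empty_iff_forall_notMem]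
  simp only [Set.mem_ofPred_eq, not_and, not_not]
  exact Iff.rfl

/-- The lower interval of `v_i` in the left weak order consists of the minimal representatives. -/
lemma mem_leftWeakIic {w : P.weylGroup} : w ∈ leftWeakIic b (vElt b i) ↔ IsMinRep b i w := by
  have h1 := length_add_length hi (vElt b i)
  rw [mul_inv_cancel, (isMinRep_iff_ncard hi _).1 (isMinRep_vElt hi)] at h1
  have h0 : length b (1 : P.weylGroup) = 0 := by
    rw [length_eq_ncard, Set.ncard_eq_zero (Set.toFinite _), Set.eq_empty_iff_forall_notMem]
    simp
  have h2 := length_add_length hi w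
  rw [leftWeakIic, Set.Finite.mem_toFinset, Set.mem_ofPred_eq, LeftWeakLE,
    isMinRep_iff_ncard hi]
  omega

/-! ### The length zero element `τ_i` -/

/-- `v_i(α_i) = -θ`. Indeed `x = θ + v_i(α_i)` is a sum of simple roots, and pairing it with the
antidominant coweight `v_i(ϖ_i^∨)` shows that all of them are orthogonal to that coweight. So `v_i⁻¹`
keeps them positive, and the height of `v_i⁻¹(x)` is positive unless `x = 0`. But this height is that of
`v_i⁻¹(θ)` plus one, where `v_i⁻¹(θ)` is negative. -/
lemma perm_vElt_node {θ : ι} (hθ : IsHighestRoot b θ) : perm P (vElt b i) i = negIdx P θ := by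
  set v := vElt b i with hv
  set μ := v • fundCoweight b i with hμ
  have hanti : ∀ {k : ι}, b.IsPos k → ip P k μ = 0 ∨ ip P k μ = -1 := fun hk => by
    rw [hμ, vElt_smul]; exact ip_antidominant hi hk
  have hneg : ¬ b.IsPos (perm P v i) := fun h => by
    have := hanti h
    rw [hμ, ip_perm, ip_simple, if_pos rfl] at this
    omega
  have hclosure : ∀ x ∈ AddSubmonoid.closure (P.root '' b.support), ∃ n : ℕ,
      P.toLinearMap x μ = -(n : K) ∧ (n = 0 → ∃ m : ℕ,
        heightForm b (((v⁻¹ : P.weylGroup) : P.Aut) • x) = m ∧ (m = 0 → x = 0)) := by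
    intro x hx
    induction hx using AddSubmonoid.closure_induction with
    | mem x hx =>
      obtain ⟨j, hj, rfl⟩ := hx
      have hjpos := b.isPos_of_mem_support hj
      rcases hanti hjpos with h | h
      · refine ⟨0, by rw [ip_spec, h]; simp, fun _ => ?_⟩
        have h1 : b.IsPos (perm P v⁻¹ j) := by
          have := (isPos_vElt_iff hi (perm P v⁻¹ j)).1 (by rwa [perm_perm_inv])
          rw [← ip_smul, h] at this
          simpa using this
        obtain ⟨m, hm⟩ := Int.eq_ofNat_of_zero_le (le_of_lt h1)
        refine ⟨m, ?_, fun h0 => ?_⟩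
        · rw [← root_perm, heightForm_root, hm, Int.cast_natCast]
        · have : 0 < b.height (perm P v⁻¹ j) := h1
          rw [hm, h0] at this
          exact absurd this (lt_irrefl _)
      · exact ⟨1, by rw [ip_spec, h]; simp, by simp⟩
    | zero => exact ⟨0, by simp, fun _ => ⟨0, by simp, by simp⟩⟩
    | add x y _ _ hx hy =>
      obtain ⟨n₁, h1, h1'⟩ := hx
      obtain ⟨n₂, h2, h2'⟩ := hy
      refine ⟨n₁ + n₂, ?_, fun h0 => ?_⟩
      · rw [map_add, LinearMap.add_apply, h1, h2]; push_cast; ring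
      · obtain ⟨m₁, h3, h3'⟩ := h1' (by omega)
        obtain ⟨m₂, h4, h4'⟩ := h2' (by omega)
        refine ⟨m₁ + m₂, ?_, fun h5 => ?_⟩
        · rw [smul_add, map_add, h3, h4]; push_cast; ring
        · rw [h3' (by omega), h4' (by omega), add_zero]
  obtain ⟨n, hn, hn'⟩ := hclosure _ (hθ (negIdx P (perm P v i)))
  rw [map_sub, LinearMap.sub_apply, ip_spec, ip_spec, ip_negIdx, hμ, ip_perm, ip_simple,
    if_pos rfl] at hn
  have hn1 : ip P θ (v • fundCoweight b i) + 1 = -n := by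
    have : ((ip P θ (v • fundCoweight b i) + 1 : ℤ) : K) = ((-n : ℤ) : K) := by
      push_cast at hn ⊢; linear_combination hn
    exact_mod_cast this
  have hθ1 : ip P θ (v • fundCoweight b i) = -1 := by
    have := hanti (highest_pos hθ)
    rw [hμ] at this
    omega
  obtain ⟨m, hm, hm'⟩ := hn' (by omega)
  have hneg' : ¬ b.IsPos (perm P v⁻¹ θ) :=
    not_isPos_of_ip_eq_neg_one hi (by rw [← ip_smul, hθ1])
  rw [smul_sub, map_sub, ← root_perm, ← root_perm, heightForm_root, heightForm_root, perm_neg,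
    perm_inv_perm, height_negIdx, RootPairing.Base.height_one_of_mem_support i.2] at hm
  have hm1 : b.height (perm P v⁻¹ θ) + 1 = m := by
    have : ((b.height (perm P v⁻¹ θ) + 1 : ℤ) : K) = ((m : ℤ) : K) := by
      push_cast at hm ⊢; linear_combination hm
    exact_mod_cast this
  have h0 : m = 0 := by
    have : ¬ 0 < b.height (perm P v⁻¹ θ) := hneg'
    have := b.height_ne_zero (perm P v⁻¹ θ)
    omega
  have h1 := P.root.injective (sub_eq_zero.1 (hm' h0))
  rw [h1, negIdx_negIdx]

omit hi in
lemma translPart_tau : translPart P (tau b i) = -(vElt b i • fundCoweight b i) := by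
  rw [tau, translPart_mul, translPart_fin, finPart_fin, translPart_transl, zero_add, smul_neg]

omit hi in
lemma finPart_tau : finPart P (tau b i) = vElt b i := by
  rw [tau, finPart_mul, finPart_fin, finPart_transl, mul_one]

omit hi in
lemma affAct_tau (r : ι × ℤ) : affAct P (tau b i) r =
    (perm P (vElt b i) r.1, r.2 + ip P r.1 (fundCoweight b i)) := by
  rw [affAct_apply, translPart_tau, finPart_tau, ip_neg, ip_perm, sub_neg_eq_add]

variable {θ : ι} (hθ : IsHighestRoot b θ)

/-- `τ_i` preserves the positive affine roots. -/
lemma pos_tau {r : ι × ℤ} (hr : (affSys hθ).pos r) :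
    (affSys hθ).pos ((affSys hθ).act (tau b i) r) := by
  change (affSys hθ).pos (affAct P (tau b i) r)
  rw [affAct_tau, affSys_pos, isPos_vElt_iff hi]
  rw [affSys_pos] at hr
  have h1 := fun h => ip_of_isPos hi (k := r.1) h
  have h2 := fun h => ip_of_not_isPos hi (k := r.1) h
  by_cases hk : b.IsPos r.1
  · rcases h1 hk with h | h <;> simp only [h, hk] at hr ⊢ <;> simp at hr ⊢ <;> omega
  · rcases h2 hk with h | h <;> simp only [h, hk] at hr ⊢ <;> simp at hr ⊢ <;> omega

lemma pos_tau_iff (r : ι × ℤ) :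
    (affSys hθ).pos ((affSys hθ).act (tau b i) r) ↔ (affSys hθ).pos r := by
  refine ⟨fun h => ?_, pos_tau hi hθ⟩
  by_contra hr
  have := pos_tau hi hθ (((affSys hθ).pos_neg r).2 hr)
  rw [(affSys hθ).act_neg, (affSys hθ).pos_neg] at this
  exact this h

/-- Conjugation by `τ_i` maps simple reflections to simple reflections or reflections in `W`, as it
sends `α_i` to the simple affine root `δ - θ` and the other simple roots to finite roots. -/
lemma exists_word_tauConj (w : P.weylGroup) :
    ∃ l, (affSys hθ).wordProd l = tauConj b i (fin P w) := by
  obtain ⟨l, rfl⟩ := exists_finWord b w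
  induction l with
  | nil => exact ⟨[], by simp [tauConj]⟩
  | cons k l ih =>
    obtain ⟨m, hm⟩ := ih
    have hk : ∃ m', (affSys hθ).wordProd m' = tauConj b i (fin P (simpleRefl b k)) := by
      have h1 : tauConj b i (fin P (simpleRefl b k)) =
          (affSys hθ).refl (affAct P (tau b i) (k, 0)) := by
        have h2 := (affSys hθ).refl_act (tau b i) (k, 0)
        have h3 : (affSys hθ).s (some k) = fin P (simpleRefl b k) := by rw [affSys_s]; rfl
        change _ = _ * (affSys hθ).s (some k) * _ at h2
        rw [h3] at h2
        exact h2.symm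
      rw [h1, affAct_tau]
      by_cases hki : k = i
      · refine ⟨[none], ?_⟩
        subst hki
        rw [perm_vElt_node hi hθ, ip_simple, if_pos rfl, ReflSys.wordProd_cons,
          ReflSys.wordProd_nil, mul_one]
        rfl
      · obtain ⟨m', -, -, hm'⟩ := exists_affWord_fin hθ
          (RootPairing.weylGroup.ofIdx P (perm P (vElt b i) k))
        refine ⟨m'.map some, ?_⟩
        rw [hm', ip_simple, if_neg hki]
        change _ = transl P _ * fin P _
        refine wext_ext P ?_ ?_
        · simp [translPart_mul]
        · simp [finPart_mul]
    obtain ⟨m', hm'⟩ := hk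
    refine ⟨m' ++ m, ?_⟩
    rw [ReflSys.wordProd_append, hm', hm, ReflSys.wordProd_cons, map_mul]
    simp only [tauConj]
    change _ = _ * (fin P (simpleRefl b k) * _) * _
    group

omit hi in
lemma tauConj_mul (w : P.weylGroup) :
    tauConj b i (fin P w) * fin P (vElt b i) * (fin P w)⁻¹ =
      tau b i * transl P (w • fundCoweight b i) := by
  have h : (tau b i)⁻¹ * fin P (vElt b i) = transl P (fundCoweight b i) := by
    rw [tau, mul_inv_rev, inv_mul_cancel_right]
    refine inv_eq_of_mul_eq_one_left ?_
    rw [transl_mul_transl, add_neg_cancel]; rfl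
  rw [tauConj, mul_assoc _ (tau b i)⁻¹, h, mul_assoc (tau b i), fin_mul_transl, mul_assoc,
    mul_assoc, mul_inv_cancel, mul_one]

lemma exists_word_tau_transl (w : P.weylGroup) :
    ∃ l, (affSys hθ).wordProd l = tau b i * transl P (w • fundCoweight b i) := by
  obtain ⟨l, hl⟩ := exists_word_tauConj hi hθ w
  obtain ⟨m, -, -, hm⟩ := exists_affWord_fin hθ (vElt b i * w⁻¹)
  refine ⟨l ++ m.map some, ?_⟩
  rw [ReflSys.wordProd_append, hl, hm, ← tauConj_mul, map_mul, map_inv, mul_assoc]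

omit hi in
lemma wordProd_mem_WAff (l : List (Option b.support)) : (affSys hθ).wordProd l ∈ WAff P := by
  rw [affSys_wordProd]
  refine Subgroup.list_prod_mem _ fun y hy => ?_
  obtain ⟨k, -, rfl⟩ := List.mem_map.1 hy
  change ((translPart P (affineRefl b θ k) : coweightLattice P) : N) ∈ corootLattice P
  rcases k with _ | k
  · change ((translPart P (transl P (corootC P θ) * fin P _) : coweightLattice P) : N) ∈ _
    rw [translPart_mul, translPart_fin, smul_zero, add_zero]
    exact coroot_mem_corootLattice P θ
  · exact zero_mem _

include hθ in
/-- `τ_i(v_i)` is shortest in its coset modulo `W`. -/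
lemma tauConj_mem_minReps : tauConj b i (fin P (vElt b i)) ∈ minReps b θ := by
  obtain ⟨l, hl⟩ := exists_word_tauConj hi hθ (vElt b i)
  refine ⟨hl ▸ wordProd_mem_WAff hθ l, fun u => ?_⟩
  rw [← affSys_len hθ, ← affSys_len hθ]
  have hx : tauConj b i (fin P (vElt b i)) = tau b i * transl P (vElt b i • fundCoweight b i) := by
    rw [← tauConj_mul, mul_inv_cancel_right]
  -- positive roots of the finite root system stay positive
  have hpos : ∀ k, b.IsPos k →
      (affSys hθ).pos ((affSys hθ).act (tauConj b i (fin P (vElt b i))) (k, 0)) := by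
    intro k hk
    rw [hx, ReflSys.act_mul, pos_tau_iff hi hθ, affSys_act, translPart_transl, finPart_transl,
      vElt_smul, perm_one, affSys_pos]
    rcases ip_antidominant hi hk with h | h
    · right; exact ⟨by rw [h]; rfl, hk⟩
    · left; rw [h]; norm_num
  obtain ⟨m, hmred, rfl, -⟩ := exists_affWord_fin hθ u
  induction m using List.reverseRecOn with
  | nil => rw [ReflSys.wordProd_nil, map_one, mul_one]
  | append_singleton m k ih =>
    refine (ih hmred.of_append_left).trans ?_
    have h1 : b.IsPos (perm P ((finSys b).wordProd m) k) := by
      by_contra hneg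
      have h2 := (finSys b).len_mul_refl_of_neg (x := (finSys b).wordProd m) rfl
        (b.isPos_of_mem_support k.2) hneg
      have h3 := (ReflSys.reduced_iff _ _).1 hmred
      have h4 := (ReflSys.reduced_iff _ _).1 hmred.of_append_left
      rw [ReflSys.wordProd_append, ReflSys.wordProd_cons, ReflSys.wordProd_nil, mul_one,
        List.length_append, List.length_singleton] at h3
      change (finSys b).len (_ * RootPairing.weylGroup.ofIdx P k) = _ at h3
      change (finSys b).len (_ * RootPairing.weylGroup.ofIdx P k) < _ at h2
      omega
    have h5 : (affSys hθ).s (some k) = fin P ((finSys b).s k) := by rw [affSys_s]; rfl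
    have h6 : (affSys hθ).wordProd (l ++ m.map some) =
        tauConj b i (fin P (vElt b i)) * fin P ((finSys b).wordProd m) := by
      rw [ReflSys.wordProd_append, hl, affSys_wordProd_some]
    have h7 := (affSys hθ).len_mul_s_of_pos h6 (k := some k) (by
      have h8 := hpos _ h1
      rw [ReflSys.act_mul]
      convert h8 using 2
      change affAct P _ ((k : ι), (0 : ℤ)) = _
      rw [affAct_apply, finPart_fin, translPart_fin, ip_zero, sub_zero])
    rw [ReflSys.wordProd_append, ReflSys.wordProd_cons, ReflSys.wordProd_nil, mul_one, map_mul,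
      ← h5, ← mul_assoc, h7]
    exact Nat.le_succ _

end Cominuscule

/-! ### The action on localized homology -/

section Action

open SkewMonoidAlgebra

variable {ι K M N : Type*} [Field K] [AddCommGroup M] [Module K M] [AddCommGroup N] [Module K N]
  (P : RootPairing ι K M N) [Finite ι] [CharZero K] [P.IsRootSystem]

lemma act_add_left (a b : QExt P) (f : LocHomology P) :
    act P (a + b) f = act P a f + act P b f := by
  refine sum_add_index' (fun x => ?_) fun x c d => ?_
  · simp
  · rw [← Finsupp.sum_add]
    refine Finsupp.sum_congr fun z _ => ?_
    rw [add_mul, AddMonoidAlgebra.single_add]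

lemma act_add_right (a : QExt P) (f g : LocHomology P) :
    act P a (f + g) = act P a f + act P a g := by
  rw [act, act, act, ← SkewMonoidAlgebra.sum_add]
  refine SkewMonoidAlgebra.sum_congr fun x _ => ?_
  rw [AddMonoidAlgebra.coeff_add]
  refine Finsupp.sum_add_index' (fun z => by simp) fun z c d => ?_
  rw [smul_add, mul_add, AddMonoidAlgebra.single_add]

lemma act_single_single (x : WExt P) (c : F P) (z : coweightLattice P) (d : F P) :
    act P (single x c) (AddMonoidAlgebra.single z d) =
      AddMonoidAlgebra.single (translPart P x + finPart P x • z) (c * x • d) := by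
  rw [act, SkewMonoidAlgebra.sum_single_index (by simp)]
  exact Finsupp.sum_single_index (by simp)

lemma act_zero_left (f : LocHomology P) : act P 0 f = 0 := by simp [act]

lemma act_zero_right (a : QExt P) : act P a 0 = 0 := by
  simp [act, SkewMonoidAlgebra.sum_def]

lemma act_sum_left {α : Type*} (s : Finset α) (a : α → QExt P) (f : LocHomology P) :
    act P (∑ n ∈ s, a n) f = ∑ n ∈ s, act P (a n) f := by
  induction s using Finset.induction_on with
  | empty => rw [Finset.sum_empty, Finset.sum_empty, act_zero_left]
  | insert n s hn ih => rw [Finset.sum_insert hn, Finset.sum_insert hn, act_add_left, ih]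

lemma act_mul (a b : QExt P) (f : LocHomology P) : act P (a * b) f = act P a (act P b f) := by
  induction a using SkewMonoidAlgebra.induction_on with
  | zero => rw [zero_mul, act_zero_left, act_zero_left]
  | add a a' ha ha' => rw [add_mul, act_add_left, act_add_left, ha, ha']
  | single x c =>
    induction b using SkewMonoidAlgebra.induction_on with
    | zero => rw [mul_zero, act_zero_left, act_zero_right]
    | add b b' hb hb' => rw [mul_add, act_add_left, act_add_left, act_add_right, hb, hb']
    | single y d =>
      induction f using AddMonoidAlgebra.induction_linear with
      | zero => simp only [act_zero_right]
      | add f g hf hg => simp only [act_add_right, hf, hg]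
      | single z e =>
        rw [single_mul_single, act_single_single, act_single_single, act_single_single,
          translPart_mul, finPart_mul, smul_add, mul_smul, add_assoc, smul_mul', ← mul_smul,
          ← mul_assoc, mul_smul x y e]

lemma act_smul (c : F P) (a : QExt P) (f : LocHomology P) : act P (c • a) f = c • act P a f := by
  induction a using SkewMonoidAlgebra.induction_on with
  | zero => rw [smul_zero, act_zero_left, smul_zero]
  | add a a' ha ha' => rw [smul_add, act_add_left, act_add_left, ha, ha', smul_add]
  | single x d =>
    induction f using AddMonoidAlgebra.induction_linear with
    | zero => simp only [act_zero_right, smul_zero]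
    | add f g hf hg => simp only [act_add_right, hf, hg, smul_add]
    | single z e =>
      rw [smul_single, act_single_single, act_single_single, AddMonoidAlgebra.smul_single,
        smul_eq_mul, smul_eq_mul, mul_assoc]

lemma j_single (y : coweightLattice P) (c : F P) :
    j P (AddMonoidAlgebra.single y c) = single (transl P y) c := by
  rw [j, AddMonoidAlgebra.liftNCRingHom_single]
  change single (1 : WExt P) c * single (transl P y) (1 : F P) = _
  rw [single_mul_single, one_mul, one_smul, mul_one]

/-- Localized homology acts on itself through `j` by multiplication. -/
lemma act_j (f g : LocHomology P) : act P (j P f) g = f * g := by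
  induction f using AddMonoidAlgebra.induction_linear with
  | zero => rw [map_zero, act_zero_left, zero_mul]
  | add f f' hf hf' => rw [map_add, act_add_left, hf, hf', add_mul]
  | single y c =>
    induction g using AddMonoidAlgebra.induction_linear with
    | zero => rw [act_zero_right, mul_zero]
    | add g g' hg hg' => rw [act_add_right, hg, hg', mul_add]
    | single z d =>
      rw [j_single, act_single_single, AddMonoidAlgebra.single_mul_single, transl_smul]
      simp

lemma act_j_psi_zero (f : LocHomology P) : act P (j P f) (psi P 0) = f := by
  rw [act_j, psi, ← AddMonoidAlgebra.one_def, mul_one]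

lemma act_delta_fin_psi_zero (w : P.weylGroup) : act P (delta P (fin P w)) (psi P 0) = psi P 0 := by
  change act P (single (fin P w) 1) (AddMonoidAlgebra.single 0 1) = _
  rw [act_single_single, smul_one, mul_one, smul_zero, translPart_fin, add_zero]
  rfl

/-- An element supported on translations is in the image of `j`. -/
lemma exists_j_eq (a : QExt P) (ha : ∀ x, a.coeff x ≠ 0 → finPart P x = 1) :
    ∃ f, j P f = a := by
  refine ⟨∑ x ∈ a.support, AddMonoidAlgebra.single (translPart P x) (a.coeff x), ?_⟩
  rw [_root_.map_sum]
  conv_rhs => rw [← SkewMonoidAlgebra.sum_single a, SkewMonoidAlgebra.sum_def']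
  refine Finset.sum_congr rfl fun x hx => ?_
  rw [j_single]
  congr 1
  exact wext_ext P rfl (ha x (SkewMonoidAlgebra.mem_support_iff.1 hx)).symm

lemma smul_eq_single_mul (c : F P) (a : QExt P) : c • a = single 1 c * a := by
  ext x
  rw [coeff_single_one_mul]
  rfl

/-- An element that commutes with all weights up to `w` is supported over `w`. -/
lemma finPart_eq_of_commutes [P.IsCrystallographic] {B : QExt P} {w : P.weylGroup}
    (h : ∀ y, B * single 1 (wtF P y) = single 1 (w • wtF P y) * B) {x : WExt P}
    (hx : B.coeff x ≠ 0) : finPart P x = w := by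
  refine (inv_mul_eq_one.1 (eq_one_of_smul_wtF P fun y => ?_)).symm
  have h1 := congrArg (fun a => a.coeff x) (h y)
  simp only [coeff_mul_single_one, coeff_single_one_mul] at h1
  rw [mul_comm] at h1
  rw [mul_smul, inv_smul_eq_iff]
  exact mul_right_cancel₀ hx h1

lemma mul_single_of_finPart_eq {B : QExt P} {w : P.weylGroup}
    (h : ∀ x, B.coeff x ≠ 0 → finPart P x = w) (c : F P) :
    B * single 1 c = single 1 (w • c) * B := by
  ext x
  rw [coeff_mul_single_one, coeff_single_one_mul, mul_comm]
  by_cases hx : B.coeff x = 0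
  · rw [hx, mul_zero, mul_zero]
  · rw [ext_smul, h x hx]

end Action

namespace NilHeckeDatum

variable {G Φ B F L : Type*} [Group G] [Field F] [MulSemiringAction G F] {R : ReflSys G Φ B}
  (D : NilHeckeDatum R F L)

/-- The last letter of a reduced word splits off from `A_x`. -/
lemma elt_eq_mul_gen {x : G} {l : List B} (hx : R.wordProd l = x) {k : B}
    (hk : ¬ R.pos (R.act x (R.simple k))) : D.elt x = D.elt (x * R.s k) * D.gen k := by
  have h1 : R.wordProd (l ++ [k]) = x * R.s k := by simp [hx]
  obtain ⟨m, hm, hlm⟩ := R.exists_word (l ++ [k])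
  rw [h1] at hm hlm
  have h2 := R.len_mul_s_of_pos h1 (k := k) (by
    rw [R.act_mul, ReflSys.s, R.act_refl_self, R.act_neg, R.pos_neg]; exact hk)
  rw [mul_assoc, R.s_mul_self, mul_one] at h2
  have h3 : R.wordProd (m ++ [k]) = x := by simp [hm, mul_assoc]
  have h4 : R.Reduced m := by rw [R.reduced_iff, hm, hlm]
  have h5 : R.Reduced (m ++ [k]) := by
    rw [R.reduced_iff, h3, h2, List.length_append, hlm]; rfl
  rw [← hm, D.elt_eq h4, ← h3, D.elt_eq h5, word_append, word_cons, word_nil, mul_one]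

end NilHeckeDatum

/-! ### The sum of the `A_{τ_i t_{w(ϖ_i^∨)}}` -/

section CominusculeSum

open SkewMonoidAlgebra

variable {ι K M N : Type*} [Field K] [AddCommGroup M] [Module K M] [AddCommGroup N] [Module K N]
  {P : RootPairing ι K M N} [Finite ι] [CharZero K] [P.IsRootSystem] [P.IsCrystallographic]
  [P.IsReduced] {b : P.Base} {i : b.support}

variable (b) in
/-- The least positive affine root of the form `β + n δ`. -/
def leastPos (k : ι) : ι × ℤ := (k, if b.IsPos k then 0 else 1)

lemma leastPos_injective : Function.Injective (leastPos b) := fun _ _ h => (Prod.mk.inj h).1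

/-- The pairing of the lower terms: `t_y s_r = t_{s_β(y)} s_{r'}` for the least positive affine roots `r`
and `r'` over `β` and `-β`, as these add up to `δ`. -/
lemma transl_mul_affRefl_leastPos {k : ι} {y : coweightLattice P} (hk : ip P k y = 1) :
    transl P y * affRefl P (leastPos b k) =
      transl P (RootPairing.weylGroup.ofIdx P k • y) * affRefl P (leastPos b (negIdx P k)) := by
  refine wext_ext P ?_ ?_
  · simp only [translPart_mul, translPart_transl, finPart_transl, one_smul, translPart_affRefl,
      ofIdx_smul_coweight, hk, leastPos, isPos_negIdx, corootC_negIdx]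
    by_cases h : b.IsPos k <;> simp [h, sub_eq_add_neg]
  · simp only [finPart_mul, finPart_transl, one_mul, finPart_affRefl, leastPos, ofIdx_negIdx]

lemma ip_ofIdx_smul {k : ι} (y : coweightLattice P) :
    ip P (negIdx P k) (RootPairing.weylGroup.ofIdx P k • y) = ip P k y :=
  ip_perm P (RootPairing.weylGroup.ofIdx P k) k y

variable (hi : IsCominuscule b i) {θ : ι} (hθ : IsHighestRoot b θ)

include hi in
lemma ip_smul_fundCoweight_mem (k : ι) (w : P.weylGroup) :
    ip P k (w • fundCoweight b i) = 0 ∨ ip P k (w • fundCoweight b i) = 1 ∨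
      ip P k (w • fundCoweight b i) = -1 := by
  rw [ip_smul]
  by_cases h : b.IsPos (perm P w⁻¹ k)
  · have := ip_of_isPos hi h
    tauto
  · have := ip_of_not_isPos hi h
    tauto

include hi in
/-- The inversions of `τ_i t_{w(ϖ_i^∨)}` correspond to the roots `β` with `⟨β, w(ϖ_i^∨)⟩ = 1`. -/
lemma inversions_tau_transl [Fintype ι] (w : P.weylGroup) (r : ι × ℤ) :
    r ∈ ({k | ip P k (w • fundCoweight b i) = 1} : Finset ι).image (leastPos b) ↔
      (affSys hθ).pos r ∧
        ¬ (affSys hθ).pos ((affSys hθ).act (tau b i * transl P (w • fundCoweight b i)) r) := by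
  obtain ⟨k, n⟩ := r
  rw [ReflSys.act_mul, pos_tau_iff hi hθ, affSys_act, affSys_pos, affSys_pos, finPart_transl,
    translPart_transl, perm_one]
  simp only [Finset.mem_image, Finset.mem_filter, Finset.mem_univ, true_and, leastPos,
    Prod.mk.injEq]
  have h := ip_smul_fundCoweight_mem hi k w
  constructor
  · rintro ⟨k, h1, rfl, h2⟩
    rw [h1]
    by_cases hk : b.IsPos k <;> simp only [hk, if_true, if_false] at h2 <;> subst h2 <;> simp [hk]
  · rintro ⟨h1, h2⟩
    refine ⟨k, ?_, rfl, ?_⟩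
    · rcases h with h | h | h
      · rw [h, sub_zero] at h2
        exact absurd h1 h2
      · exact h
      · rw [h] at h2
        exact absurd (Or.inl (by omega)) h2
    · by_cases hk : b.IsPos k <;> simp only [hk, and_true, and_false, or_false, if_true, if_false]
        at h1 h2 ⊢ <;> omega

include hi in
/-- All the `τ_i t_{w(ϖ_i^∨)}` have the same length. -/
lemma len_tau_transl (w : P.weylGroup) :
    (affSys hθ).len (tau b i * transl P (w • fundCoweight b i)) =
      {k | ip P k (fundCoweight b i) = 1}.ncard := by
  let := Fintype.ofFinite ι
  obtain ⟨l, hl⟩ := exists_word_tau_transl hi hθ w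
  rw [(affSys hθ).len_eq_ncard hl]
  have h1 : {r | (affSys hθ).pos r ∧ ¬ (affSys hθ).pos ((affSys hθ).act
      (tau b i * transl P (w • fundCoweight b i)) r)} =
      (fun k => leastPos b (perm P w k)) '' {k | ip P k (fundCoweight b i) = 1} := by
    ext r
    rw [Set.mem_ofPred_eq, ← inversions_tau_transl hi hθ, Finset.mem_image]
    constructor
    · rintro ⟨k, hk, rfl⟩
      rw [Finset.mem_filter, ip_smul] at hk
      exact ⟨perm P w⁻¹ k, hk.2, by simp only [perm_perm_inv]⟩
    · rintro ⟨k, hk, rfl⟩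
      refine ⟨perm P w k, ?_, rfl⟩
      rw [Finset.mem_filter, ip_perm]
      exact ⟨Finset.mem_univ _, hk⟩
  rw [h1, Set.ncard_image_of_injective]
  exact leastPos_injective.comp (perm P w).injective

include hi in
/-- The lower order terms of the commutation relations of the `A_{τ_i t_{w(ϖ_i^∨)}}` cancel in pairs,
the term of `(w, β)` against that of the representative of `s_β w` and `-β`. -/
lemma sum_lower_terms_eq_zero [Fintype ι] (n : ℕ) (y : weightLattice P) :
    ∑ w ∈ leftWeakIic b (vElt b i), ∑ k : ι with ip P k (w • fundCoweight b i) = 1,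
      wp P k y • (if (affSys hθ).len (tau b i * transl P (w • fundCoweight b i) *
          affRefl P (leastPos b k)) + 1 = n
        then (affDatum hθ).elt (tau b i * transl P (w • fundCoweight b i) *
          affRefl P (leastPos b k)) else 0) = 0 := by
  rw [Finset.sum_sigma']
  choose c hc hc' using fun w : P.weylGroup => exists_isMinRep hi w
  refine Finset.sum_involution
    (fun p _ => ⟨c (RootPairing.weylGroup.ofIdx P p.2 * p.1), negIdx P p.2⟩) ?_ ?_ ?_ ?_
  · rintro ⟨w, k⟩ hp
    simp only [Finset.mem_sigma, Finset.mem_filter, Finset.mem_univ, true_and] at hp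
    simp only [hc', mul_smul, wp_negIdx]
    rw [mul_assoc, mul_assoc, transl_mul_affRefl_leastPos hp.2, neg_smul, add_neg_cancel]
  · rintro ⟨w, k⟩ hp - h
    have h1 : negIdx P k = k := (Sigma.mk.inj h).2.eq
    have h2 := isPos_negIdx b k
    rw [h1] at h2
    tauto
  · rintro ⟨w, k⟩ hp
    simp only [Finset.mem_sigma, Finset.mem_filter, Finset.mem_univ, true_and] at hp ⊢
    refine ⟨(mem_leftWeakIic hi).2 (hc _), ?_⟩
    rw [hc', mul_smul, ip_ofIdx_smul]
    exact hp.2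
  · rintro ⟨w, k⟩ hp
    simp only [Finset.mem_sigma] at hp
    have h1 : c (RootPairing.weylGroup.ofIdx P (negIdx P k) *
        c (RootPairing.weylGroup.ofIdx P k * w)) = w := by
      refine (hc _).eq hi ((mem_leftWeakIic hi).1 hp.1) ?_
      rw [hc', mul_smul, hc', ofIdx_negIdx, ← mul_smul, ← mul_assoc, ofIdx_mul_self, one_mul]
    simp only [h1, negIdx_negIdx]

variable (i) in
/-- The sum of the `A_{τ_i t_{w(ϖ_i^∨)}}` over the minimal representatives `w`. -/
def cominusculeSum : QExt P :=
  ∑ w ∈ leftWeakIic b (vElt b i), (affDatum hθ).elt (tau b i * transl P (w • fundCoweight b i))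

include hi in
/-- The sum commutes with weights up to `v_i`: only the leading terms of the commutation relations
remain. -/
lemma cominusculeSum_mul_wtF (y : weightLattice P) :
    cominusculeSum i hθ * single 1 (wtF P y) =
      single 1 (vElt b i • wtF P y) * cominusculeSum i hθ := by
  let := Fintype.ofFinite ι
  rw [cominusculeSum, Finset.sum_mul, Finset.mul_sum]
  have h : ∀ w ∈ leftWeakIic b (vElt b i),
      (affDatum hθ).elt (tau b i * transl P (w • fundCoweight b i)) * single 1 (wtF P y) =
      single 1 (vElt b i • wtF P y) *
        (affDatum hθ).elt (tau b i * transl P (w • fundCoweight b i)) +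
      ∑ k : ι with ip P k (w • fundCoweight b i) = 1,
        wp P k y • (if (affSys hθ).len (tau b i * transl P (w • fundCoweight b i) *
            affRefl P (leastPos b k)) + 1 = {k | ip P k (fundCoweight b i) = 1}.ncard
          then (affDatum hθ).elt (tau b i * transl P (w • fundCoweight b i) *
            affRefl P (leastPos b k)) else 0) := by
    intro w _
    obtain ⟨l, hl⟩ := exists_word_tau_transl hi hθ w
    have h1 := (affDatum hθ).elt_mul_wt hl _ (inversions_tau_transl hi hθ w) y
    rw [Finset.sum_image leastPos_injective.injOn, len_tau_transl hi hθ] at h1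
    have h2 : (tau b i * transl P (w • fundCoweight b i)) • wtF P y = vElt b i • wtF P y := by
      rw [ext_smul, finPart_mul, finPart_tau, finPart_transl, mul_one]
    exact h1.trans (by rw [← h2]; rfl)
  rw [Finset.sum_congr rfl h, Finset.sum_add_distrib, sum_lower_terms_eq_zero hi hθ, add_zero]

include hi in
lemma finPart_of_cominusculeSum_coeff_ne_zero {x : WExt P}
    (hx : (cominusculeSum i hθ).coeff x ≠ 0) : finPart P x = vElt b i :=
  finPart_eq_of_commutes P (cominusculeSum_mul_wtF hi hθ) hx

include hi in
/-- The double sum over `w ≤_L v_i` and `v ≤ v_i⁻¹`, in closed form: the scalars move past the sum over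
`w`, and the sum over `v` is a localization formula. -/
lemma sum_sum_eq : ∑ w ∈ leftWeakIic b (vElt b i), ∑ v ∈ bruhatIic b (vElt b i)⁻¹,
    (tau b i • schubertValue b θ v (vElt b i)⁻¹) •
      (nilHecke b θ (tauConj b i (fin P w) * fin P (vElt b i) * (fin P w)⁻¹) *
        nilHecke b θ (fin P v)) =
    cominusculeSum i hθ * delta P (fin P (vElt b i)⁻¹) := by
  rw [Finset.sum_comm, ← sum_schubertValue hθ, Finset.mul_sum]
  refine Finset.sum_congr rfl fun v _ => ?_
  rw [smul_eq_single_mul P (schubertValue b θ v (vElt b i)⁻¹), ← mul_assoc,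
    mul_single_of_finPart_eq P (fun x => finPart_of_cominusculeSum_coeff_ne_zero hi hθ),
    ← smul_eq_single_mul, cominusculeSum, Finset.smul_sum, Finset.sum_mul]
  refine Finset.sum_congr rfl fun w _ => ?_
  rw [tauConj_mul, nilHecke_eq hθ (_ * transl P _), ext_smul, finPart_tau, smul_eq_single_mul,
    smul_eq_single_mul, mul_assoc]

include hi in
/-- The sum is in the image of `j`, since it commutes with `Frac(S)`. -/
lemma exists_j_eq_cominusculeSum :
    ∃ f, j P f = cominusculeSum i hθ * delta P (fin P (vElt b i)⁻¹) := by
  refine exists_j_eq P _ fun x hx => ?_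
  change (cominusculeSum i hθ * single (fin P (vElt b i)⁻¹) (1 : F P)).coeff x ≠ 0 at hx
  rw [coeff_mul_single] at hx
  have h := finPart_of_cominusculeSum_coeff_ne_zero hi hθ (left_ne_zero_of_mul hx)
  rw [finPart_mul, finPart_inv, finPart_fin, inv_inv] at h
  exact mul_eq_right.1 h

include hi in
/-- Unless `w = v_i`, the element `τ_i t_{w(ϖ_i^∨)}` is not shortest in its coset modulo `W`, and its
nil-Hecke element kills the base point. -/
lemma act_elt_tau_transl_eq_zero {w : P.weylGroup} (hw : IsMinRep b i w) (hne : w ≠ vElt b i) :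
    act P ((affDatum hθ).elt (tau b i * transl P (w • fundCoweight b i))) (psi P 0) = 0 := by
  have h : ∃ k : b.support, ip P k (w • fundCoweight b i) = 1 := by
    by_contra! h
    refine hne (hw.eq_vElt hi fun k hk => ?_)
    have hs : ∀ j ∈ b.support, ip P j (w • fundCoweight b i) ≤ 0 := by
      intro j hj
      have h1 := h ⟨j, hj⟩
      have h2 := ip_smul_fundCoweight_mem hi j w
      simp only at h1
      omega
    refine hk.induction_on_add (p := fun k => ip P k (w • fundCoweight b i) ≤ 0) hs ?_
    intro k j l hl hk' hj
    have := hs j hj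
    have := ip_add_root hl (w • fundCoweight b i)
    omega
  obtain ⟨k, hk⟩ := h
  obtain ⟨l, hl⟩ := exists_word_tau_transl hi hθ w
  rw [(affDatum hθ).elt_eq_mul_gen hl (k := some k), act_mul]
  · have h0 : act P ((affDatum hθ).gen (some k)) (psi P 0) = 0 := by
      rw [affDatum_gen]
      change act P ((rootF P k)⁻¹ • (1 - delta P (fin P (simpleRefl b k)))) _ = 0
      have h1 : act P (1 - delta P (fin P (simpleRefl b k))) (psi P 0) +
          act P (delta P (fin P (simpleRefl b k))) (psi P 0) = psi P 0 := by
        rw [← act_add_left, sub_add_cancel, ← map_one (delta P), ← map_one (fin P),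
          act_delta_fin_psi_zero]
      rw [act_delta_fin_psi_zero, add_eq_right] at h1
      rw [act_smul, h1, smul_zero]
    rw [h0, act_zero_right]
  · change ¬ (affSys hθ).pos ((affSys hθ).act _ ((k : ι), (0 : ℤ)))
    rw [ReflSys.act_mul, pos_tau_iff hi hθ, affSys_act, affSys_pos, finPart_transl,
      translPart_transl, perm_one, hk]
    simp

include hi in
/-- The closed form of the sum is the image under `j` of the Schubert class of `τ_i(v_i)`. -/
lemma j_schubertClass :
    j P (schubertClass b θ (tauConj b i (fin P (vElt b i)))) =
      cominusculeSum i hθ * delta P (fin P (vElt b i)⁻¹) := by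
  obtain ⟨f, hf⟩ := exists_j_eq_cominusculeSum hi hθ
  rw [← hf]
  congr 1
  rw [← act_j_psi_zero P f, hf, act_mul, act_delta_fin_psi_zero, cominusculeSum, act_sum_left,
    Finset.sum_eq_single_of_mem (vElt b i) ((mem_leftWeakIic hi).2 (isMinRep_vElt hi))
      fun w hw hne => act_elt_tau_transl_eq_zero hi hθ ((mem_leftWeakIic hi).1 hw) hne,
    schubertClass, nilHecke_eq hθ, ← tauConj_mul, mul_inv_cancel_right]

end CominusculeSum

end AffineGrassmannian

end

theorem mainTheorem5 {ι K M N : Type*} [Finite ι] [Field K] [CharZero K]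
    [AddCommGroup M] [Module K M] [AddCommGroup N] [Module K N]
    (P : RootPairing ι K M N) [P.IsRootSystem] [P.IsCrystallographic] [P.IsReduced]
    [P.IsIrreducible] (b : P.Base) (θ : ι) (hθ : IsHighestRoot b θ)
    (i : b.support) (hi : IsCominuscule b i) :
    tauConj b i (fin P (vElt b i)) ∈ minReps b θ ∧
    j P (schubertClass b θ (tauConj b i (fin P (vElt b i)))) =
      ∑ w ∈ leftWeakIic b (vElt b i), ∑ v ∈ bruhatIic b (vElt b i)⁻¹,
        (tau b i • schubertValue b θ v (vElt b i)⁻¹) •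
          (nilHecke b θ (tauConj b i (fin P w) * fin P (vElt b i) * (fin P w)⁻¹) *
            nilHecke b θ (fin P v)) ∧
    ∀ x ∈ homologyOmegaK b θ,
      schubertClass b θ (tauConj b i (fin P (vElt b i))) * x =
        ∑ w ∈ leftWeakIic b (vElt b i), ∑ v ∈ bruhatIic b (vElt b i)⁻¹,
          (tau b i • schubertValue b θ v (vElt b i)⁻¹) •
            act P (nilHecke b θ (tauConj b i (fin P w) * fin P (vElt b i) * (fin P w)⁻¹))
              (act P (nilHecke b θ (fin P v)) x) := by
  have hj := (j_schubertClass hi hθ).trans (sum_sum_eq hi hθ).symm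
  refine ⟨tauConj_mem_minReps hi hθ, hj, fun x _ => ?_⟩
  rw [← act_j, hj, act_sum_left]
  refine Finset.sum_congr rfl fun w _ => ?_
  rw [act_sum_left]
  refine Finset.sum_congr rfl fun v _ => ?_
  rw [act_smul, act_mul]
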